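/- All graphs are finite, simple and undirected. Let $G$ be a graph and $M$ a maximum matching of $G$ (a matching with the largest possible number of edges). A walk is $M$-alternating if, of any two consecutive edges, exactly one is in $M$; a path is a walk without repeated vertices. An $M$-blossom is an odd cycle of length $2k+1$ with exactly $k$ edges in $M$; its base is the unique vertex that is not matched by $M$ to another vertex of the cycle. An $M$-flower consists of an $M$-blossom together with an $M$-alternating path of even length (possibly zero) from its base to a vertex unmatched by $M$, the base being the only vertex common to the blossom and the path. An $M$-Jflower consists of an $M$-blossom together with an $M$-alternating walk of even length (possibly zero, vertices and edges may repeat) from its base to a vertex unmatched by $M$. An $M$-Tposy consists of two distinct (not necessarily disjoint) $M$-blossoms together with an $M$-alternating path of odd length, starting and ending with edges of $M$, whose endpoints are the bases of the two blossoms and none of whose internal vertices lies in either blossom. $G$ is a Jflower-graph if, for some maximum matching $M$ of $G$, there is an $M$-Jflower of $G$ that uses all the vertices and all the edges of $G$. Theorem. If $G$ is a Jflower-graph, then for every vertex $v$ of $G$ there is a maximum matching $M$ of $G$ such that $v$ lies in an $M$-flower or in an $M$-Tposy of $G$. -/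

import Mathlib

namespace SterboulDeming

variable {V : Type*} {G : SimpleGraph V}

/-- `M` is a maximum matching of `G`: a matching with the largest possible number of edges. -/
def IsMaximumMatching (M : G.Subgraph) : Prop :=
  M.IsMatching ∧ ∀ N : G.Subgraph, N.IsMatching → N.edgeSet.ncard ≤ M.edgeSet.ncard

/-- The walk `W` is `M`-alternating: of any two consecutive edges, exactly one belongs to `M`. -/
def IsAlternatingWalk (M : G.Subgraph) {u v : V} (W : G.Walk u v) : Prop :=
  W.edges.IsChain fun e f => e ∈ M.edgeSet ↔ f ∉ M.edgeSet

/-- The closed walk `C` traces an `M`-blossom with base `b`: an odd cycle of length `2 * k + 1`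
with exactly `k` edges in `M`, where `b` is not matched by `M` to a vertex of the cycle. -/
def IsBlossom (M : G.Subgraph) {b : V} (C : G.Walk b b) : Prop :=
  C.IsCycle ∧
    (∃ k : ℕ, C.length = 2 * k + 1 ∧ {e | e ∈ C.edges ∧ e ∈ M.edgeSet}.ncard = k) ∧
    ∀ w ∈ C.support, ¬ M.Adj b w

/-- The `M`-blossom `C` and the walk `S` form an `M`-flower: `S` is an `M`-stem, that is, an
even-length `M`-alternating path from the base to an unmatched vertex that meets the blossom
only at the base. The stem may have length zero. -/
def IsFlower (M : G.Subgraph) {b u : V} (C : G.Walk b b) (S : G.Walk b u) : Prop :=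
  IsBlossom M C ∧ S.IsPath ∧ IsAlternatingWalk M S ∧ Even S.length ∧ u ∉ M.verts ∧
    ∀ x ∈ C.support, x ∈ S.support → x = b

/-- The `M`-blossom `C` and the walk `W` form an `M`-Jflower: `W` is an even-length
`M`-alternating walk (repetitions allowed) from the base to an unmatched vertex. -/
def IsJflower (M : G.Subgraph) {b u : V} (C : G.Walk b b) (W : G.Walk b u) : Prop :=
  IsBlossom M C ∧ IsAlternatingWalk M W ∧ Even W.length ∧ u ∉ M.verts

/-- The `M`-blossoms `C₁`, `C₂` and the walk `P` form an `M`-posy: the blossoms are distinct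
(as subgraphs), and `P` is an odd-length `mm`-alternating path between their bases. -/
def IsPosy (M : G.Subgraph) {a b : V} (C₁ : G.Walk a a) (C₂ : G.Walk b b) (P : G.Walk a b) :
    Prop :=
  IsBlossom M C₁ ∧ IsBlossom M C₂ ∧ C₁.toSubgraph ≠ C₂.toSubgraph ∧
    P.IsPath ∧ IsAlternatingWalk M P ∧ Odd P.length ∧ M.Adj a P.snd ∧ M.Adj P.penultimate b

/-- An `M`-Tposy is an `M`-posy whose path is internally disjoint from both blossoms. -/
def IsTposy (M : G.Subgraph) {a b : V} (C₁ : G.Walk a a) (C₂ : G.Walk b b) (P : G.Walk a b) :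
    Prop :=
  IsPosy M C₁ C₂ P ∧
    ∀ x ∈ P.support, x ≠ a → x ≠ b → x ∉ C₁.support ∧ x ∉ C₂.support

/-- The vertex `v` lies in some `M`-flower of `G`. -/
def MemFlower (M : G.Subgraph) (v : V) : Prop :=
  ∃ (b u : V) (C : G.Walk b b) (S : G.Walk b u),
    IsFlower M C S ∧ (v ∈ C.support ∨ v ∈ S.support)

/-- The vertex `v` lies in some `M`-Tposy of `G`. -/
def MemTposy (M : G.Subgraph) (v : V) : Prop :=
  ∃ (a b : V) (C₁ : G.Walk a a) (C₂ : G.Walk b b) (P : G.Walk a b),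
    IsTposy M C₁ C₂ P ∧ (v ∈ C₁.support ∨ v ∈ C₂.support ∨ v ∈ P.support)

/-- `G` is a Jflower-graph: for some maximum matching `M`, there is an `M`-Jflower of `G` that
uses all the vertices and all the edges of `G`. -/
def IsJflowerGraph (G : SimpleGraph V) : Prop :=
  ∃ M : G.Subgraph, IsMaximumMatching M ∧
    ∃ (b u : V) (C : G.Walk b b) (W : G.Walk b u), IsJflower M C W ∧
      (∀ v : V, v ∈ C.support ∨ v ∈ W.support) ∧
      ∀ e ∈ G.edgeSet, e ∈ C.edges ∨ e ∈ W.edges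

end SterboulDeming

/-! Encode a matching that misses only `u` as an involution `f` fixing `u`, and draw an arc from `x`
to `z` when `x` is adjacent to `f z`. For `z` different from `x` and `u` this is a non-matching edge
followed by a matching edge. The digraph is skew-symmetric, as in 2-SAT: an arc from `x` to `z`
gives one from `f z` to `f x`. In a Jflower-graph every vertex is reachable from `u`: the stem leads
to the base `b`, the blossom to `f b`, and conjugate walks supply the other end of each matching
edge (`exists_isMate`). By conjugation every vertex also reaches `u`, so the digraph is strongly
connected.

A walk in this digraph need not be a path of `G`: it may use both ends of a matching edge, or repeat
a vertex. The first is excluded by staying in a consistent set, which contains at most one end of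
each matching edge; a simple walk there is an alternating path. The second matters because the walk
must pass through `v`, so it cannot simply be shortcut. It is cured by changing the matching:
rotating the partners along a cycle of the walk shortens it, keeps it at the matching edge of `v`,
and loses no reachability (`exists_rematch_path`). This is why the matching depends on `v`.

By strong connectivity a maximal consistent set must be left along an arc, and by maximality that
arc exposes an edge between two members (`exists_edge_or_new`). If some consistent set grown from
`u` contains `v` or `f v`, the edge joins two branches into a blossom whose stem ends at `u`: a
flower (`exists_memFlower`). Otherwise grow from `f v`; the closing edge gives a blossom whose
conjugated stem leads to `v` (`exists_config`). Exploring onwards from `v` either finds a second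
closing edge, hence a Tposy, or runs into the first blossom and enlarges the configuration; meeting
`u` would bring back the flower case. Finiteness ends the process. -/

namespace SterboulDeming

/-! ### Walks of a relation as lists. -/

section ListChains

variable {α : Type*}

/-- `l` lists the successive points of an `r`-walk from `a` to `b`. -/
def ChainFrom (r : α → α → Prop) (a : α) (l : List α) (b : α) : Prop :=
  l.IsChain r ∧ l.head? = some a ∧ l.getLast? = some b

namespace ChainFrom

variable {r s : α → α → Prop} {a b c : α} {l l₁ l₂ : List α}

theorem ne_nil (h : ChainFrom r a l b) : l ≠ [] := by
  rintro rfl; simp [ChainFrom] at h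

theorem refl (r : α → α → Prop) (a : α) : ChainFrom r a [a] a := by simp [ChainFrom]

theorem start_mem (h : ChainFrom r a l b) : a ∈ l := List.mem_of_mem_head? h.2.1

theorem end_mem (h : ChainFrom r a l b) : b ∈ l := List.mem_of_mem_getLast? h.2.2

theorem cons (hac : r a c) (h : ChainFrom r c l b) : ChainFrom r a (a :: l) b := by
  obtain ⟨h1, h2, h3⟩ := h
  cases l with
  | nil => simp at h2
  | cons x l => simp_all [ChainFrom]

theorem split_iff :
    ChainFrom r a (l₁ ++ c :: l₂) b ↔ ChainFrom r a (l₁ ++ [c]) c ∧ ChainFrom r c (c :: l₂) b := by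
  unfold ChainFrom
  rw [List.isChain_split]
  have h1 : (l₁ ++ c :: l₂).head? = (l₁ ++ [c]).head? := by cases l₁ <;> simp
  have h2 : (l₁ ++ c :: l₂).getLast? = (c :: l₂).getLast? := by
    exact List.getLast?_append_of_ne_nil _ (by simp)
  rw [h1, h2]; simp; tauto

theorem join_iff :
    ChainFrom r a (l₁ ++ c :: l₂) b ∧ l₁ ≠ [] ↔
      ∃ d, ChainFrom r a l₁ d ∧ r d c ∧ ChainFrom r c (c :: l₂) b := by
  rcases l₁.eq_nil_or_concat with rfl | ⟨l, d, rfl⟩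
  · simp [ChainFrom]
  · have e : l ++ [d] ++ c :: l₂ = l ++ d :: c :: l₂ := by simp
    simp only [List.concat_eq_append]
    rw [e, split_iff]
    constructor
    · rintro ⟨⟨h1, h2⟩, -⟩
      refine ⟨d, h1, ?_, ?_⟩
      · exact (List.isChain_cons_cons.1 h2.1).1
      · exact ⟨(List.isChain_cons_cons.1 h2.1).2, by simp, by simpa [ChainFrom] using h2.2.2⟩
    · rintro ⟨d', h1, h2, h3⟩
      obtain rfl : d = d' := by simpa using h1.2.2
      exact ⟨⟨h1, h3.cons h2⟩, by simp⟩

theorem append (h₁ : ChainFrom r a l₁ c) {d : α} (hcd : r c d) (h₂ : ChainFrom r d l₂ b) :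
    ChainFrom r a (l₁ ++ l₂) b := by
  cases l₂ with
  | nil => exact absurd rfl h₂.ne_nil
  | cons x l =>
    obtain rfl : x = d := by simpa using h₂.2.1
    exact (join_iff.2 ⟨c, h₁, hcd, h₂⟩).1

theorem mono (h : ChainFrom r a l b) (hrs : ∀ x ∈ l, ∀ y ∈ l, r x y → s x y) :
    ChainFrom s a l b :=
  ⟨h.1.imp_of_mem_imp fun {x y} hx hy hxy => hrs x hx y hy hxy, h.2⟩

theorem reverse (h : ChainFrom r a l b) : ChainFrom (fun x y => r y x) b l.reverse a := by
  refine ⟨List.isChain_reverse.2 h.1, ?_, ?_⟩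
  · rw [List.head?_reverse, h.2.2]
  · rw [List.getLast?_reverse, h.2.1]

theorem map {β : Type*} {t : β → β → Prop} (g : α → β) (h : ChainFrom r a l b)
    (hg : ∀ x ∈ l, ∀ y ∈ l, r x y → t (g x) (g y)) : ChainFrom t (g a) (l.map g) (g b) := by
  refine ⟨?_, by simp [h.2.1], by simp [h.2.2]⟩
  rw [List.isChain_map]
  exact h.1.imp_of_mem_imp fun {x y} hx hy hxy => hg x hx y hy hxy

theorem reach (h : ChainFrom r a l b) : Relation.ReflTransGen r a b := by
  induction l generalizing a with
  | nil => exact absurd rfl h.ne_nil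
  | cons x l ih =>
    obtain rfl : x = a := by simpa using h.2.1
    cases l with
    | nil => obtain rfl : x = b := by simpa using h.2.2
             exact .refl
    | cons y l =>
      have h1 := List.isChain_cons_cons.1 h.1
      exact .head h1.1 (ih ⟨h1.2, by simp, by simpa using h.2.2⟩)

theorem exists_nodup (h : ChainFrom r a l b) :
    ∃ l', ChainFrom r a l' b ∧ l'.Nodup ∧ l' ⊆ l ∧ l'.length ≤ l.length := by
  classical
  induction l generalizing a with
  | nil => exact absurd rfl h.ne_nil
  | cons x l ih =>
    obtain rfl : x = a := by simpa using h.2.1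
    cases l with
    | nil => exact ⟨[x], h, by simp, by simp, by simp⟩
    | cons y l =>
      have h1 := List.isChain_cons_cons.1 h.1
      obtain ⟨l', h2, h3, h4, h5⟩ :=
        ih (a := y) ⟨h1.2, by simp, by simpa using h.2.2⟩
      by_cases hx : x ∈ l'
      · obtain ⟨s, t, rfl⟩ := List.append_of_mem hx
        refine ⟨x :: t, (split_iff.1 h2).2, (List.nodup_append.1 h3).2.1, ?_, ?_⟩
        · exact fun z hz => List.mem_cons_of_mem _ (h4 (List.mem_append_right _ hz))
        · simp at h5 ⊢; omega
      · refine ⟨x :: l', h2.cons h1.1, List.nodup_cons.2 ⟨hx, h3⟩, ?_, ?_⟩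
        · exact List.cons_subset_cons _ h4
        · simpa using h5

end ChainFrom

variable {r : α → α → Prop} {a b : α}

theorem exists_chainFrom_of_reach (h : Relation.ReflTransGen r a b) :
    ∃ l, ChainFrom r a l b ∧ l.Nodup := by
  have : ∃ l, ChainFrom r a l b := by
    induction h using Relation.ReflTransGen.head_induction_on with
    | refl => exact ⟨[b], .refl r b⟩
    | head h' _ ih => obtain ⟨l, hl⟩ := ih; exact ⟨_, hl.cons h'⟩
  obtain ⟨l, hl⟩ := this
  obtain ⟨l', h1, h2, -⟩ := hl.exists_nodup
  exact ⟨l', h1, h2⟩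

/-- Split a list at the first element satisfying `p`. -/
theorem exists_split_first {p : α → Prop} {l : List α} (h : ∃ x ∈ l, p x) :
    ∃ l₁ x l₂, l = l₁ ++ x :: l₂ ∧ p x ∧ ∀ y ∈ l₁, ¬ p y := by
  induction l with
  | nil => simp at h
  | cons c l ih =>
    by_cases hc : p c
    · exact ⟨[], c, l, by simp, hc, by simp⟩
    · obtain ⟨l₁, x, l₂, rfl, h1, h2⟩ := ih (by simpa [hc] using h)
      exact ⟨c :: l₁, x, l₂, by simp, h1, by simpa [hc] using h2⟩

/-- Split a list at the last element satisfying `p`. -/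
theorem exists_split_last {p : α → Prop} {l : List α} (h : ∃ x ∈ l, p x) :
    ∃ l₁ x l₂, l = l₁ ++ x :: l₂ ∧ p x ∧ ∀ y ∈ l₂, ¬ p y := by
  obtain ⟨l₁, x, l₂, h1, h2, h3⟩ := exists_split_first (p := p) (l := l.reverse) (by simpa using h)
  refine ⟨l₂.reverse, x, l₁.reverse, ?_, h2, by simpa using h3⟩
  rw [← l.reverse_reverse, h1]; simp

/-- A walk from a member `x` of a set to `b` has a last exit `p` from the set. -/
theorem exists_last_exit {x : α} {S : Set α} (h : Relation.ReflTransGen r x b) (hx : x ∈ S) :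
    ∃ p ∈ S, ∃ l, ChainFrom r p (p :: l) b ∧ (p :: l).Nodup ∧ (∀ y ∈ l, y ∉ S) ∧
      Relation.ReflTransGen r x p := by
  obtain ⟨l, hl, hn⟩ := exists_chainFrom_of_reach h
  obtain ⟨l₁, p, l₂, rfl, h1, h2⟩ :=
    exists_split_last (p := fun y => y ∈ S) (l := l) ⟨x, hl.start_mem, hx⟩
  have h3 := ChainFrom.split_iff.1 hl
  exact ⟨p, h1, l₂, h3.2, (List.nodup_append.1 hn).2.1, h2, h3.1.reach⟩

/-- A walk from `x` to a member `b` of a set has a first entry `p` into the set. -/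
theorem exists_first_entry {x : α} {S : Set α} (h : Relation.ReflTransGen r x b) (hb : b ∈ S) :
    ∃ p ∈ S, ∃ l, ChainFrom r x (l ++ [p]) p ∧ (l ++ [p]).Nodup ∧ (∀ y ∈ l, y ∉ S) := by
  obtain ⟨l, hl, hn⟩ := exists_chainFrom_of_reach h
  obtain ⟨l₁, p, l₂, rfl, h1, h2⟩ :=
    exists_split_first (p := fun y => y ∈ S) (l := l) ⟨b, hl.end_mem, hb⟩
  have h3 := ChainFrom.split_iff.1 hl
  refine ⟨p, h1, l₁, h3.1, ?_, h2⟩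
  rw [List.append_cons] at hn
  exact (List.nodup_append.1 hn).1

/-- The cyclic permutation along a list without repetitions. -/
theorem exists_cyclic_perm {l : List α} (hl : l.Nodup) (hne : l ≠ []) :
    ∃ ρ : Equiv.Perm α, (∀ x ∉ l, ρ x = x) ∧ (∀ s x y t, l = s ++ x :: y :: t → ρ x = y) ∧
      (∀ x y, l.getLast? = some x → l.head? = some y → ρ x = y) := by
  classical
  refine ⟨l.formPerm, fun x hx => List.formPerm_apply_of_notMem hx, ?_, ?_⟩
  · rintro s x y t rfl
    have h := List.formPerm_apply_lt_getElem _ hl s.length (by simp)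
    simpa using h
  · intro x y hx hy
    cases l with
    | nil => simp at hne
    | cons c l =>
      have := List.formPerm_apply_getLast c l
      obtain rfl : c = y := by simpa using hy
      rw [List.getLast?_eq_getLast_of_ne_nil (by simp)] at hx
      obtain rfl : _ = x := by simpa using hx
      exact this

end ListChains

end SterboulDeming

/-! ### The implication digraph of a matching; alternating paths and blossoms from chains. -/

namespace SterboulDeming

variable {V : Type*} {G : SimpleGraph V}

/-- `f` encodes a matching of `G` whose only unmatched vertex is `u`: matched vertices are sent to
their partners and `u` is fixed. -/
structure IsMate (G : SimpleGraph V) (f : V → V) (u : V) : Prop where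
  inv : ∀ x, f (f x) = x
  adj : ∀ x, x ≠ u → G.Adj x (f x)
  fix : f u = u

namespace IsMate

variable {f : V → V} {u : V} (h : IsMate G f u)

include h in
theorem inj {x y : V} (hxy : f x = f y) : x = y := by rw [← h.inv x, hxy, h.inv]

include h in
theorem eq_comm {x y : V} : f x = y ↔ x = f y :=
  ⟨fun e => by rw [← e, h.inv], fun e => by rw [e, h.inv]⟩

include h in
theorem apply_ne {x : V} (hx : x ≠ u) : f x ≠ x := fun e => (h.adj x hx).ne e.symm

include h in
theorem apply_ne_root {x : V} (hx : x ≠ u) : f x ≠ u := fun e => hx (by rw [← h.inv x, e, h.fix])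

/-- The matching encoded by `f`. -/
def matching : G.Subgraph where
  verts := {x | x ≠ u}
  Adj x y := x ≠ u ∧ f x = y
  adj_sub := by rintro x y ⟨hx, rfl⟩; exact h.adj x hx
  edge_vert := fun hxy => hxy.1
  symm := ⟨by rintro x y ⟨hx, rfl⟩; exact ⟨h.apply_ne_root hx, h.inv x⟩⟩

theorem mem_matching_edgeSet {x y : V} : s(x, y) ∈ h.matching.edgeSet ↔ x ≠ u ∧ f x = y :=
  SimpleGraph.Subgraph.mem_edgeSet

theorem isMatching : h.matching.IsMatching :=
  fun x hx => ⟨f x, ⟨hx, rfl⟩, fun _ hy => hy.2.symm⟩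

end IsMate

/-- The implication relation of the matching encoded by `f`: a walk from `x` passes over an edge
outside the matching and then over the matching edge ending in `z`. -/
def Arc (G : SimpleGraph V) (f : V → V) (x z : V) : Prop := G.Adj x (f z)

/-- The matching edges through the members of `L` are pairwise different. -/
def DistinctNodes (f : V → V) (L : List V) : Prop := L.Pairwise fun x y => x ≠ y ∧ x ≠ f y

section Walks

variable {f : V → V} {u : V}

/-- The same edge between `x` and `f z`, traversed backwards. This skew symmetry drives the whole
proof. -/
theorem IsMate.arc_conj (h : IsMate G f u) {x z : V} (hxz : Arc G f x z) :
    Arc G f (f z) (f x) := by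
  unfold Arc at *
  rw [h.inv]; exact hxz.symm

/-- Each arc into `c` expands to two edges, through `f c`. Since no matching edge occurs twice, the
inserted partners are new vertices and the result is a path. -/
theorem exists_walk (h : IsMate G f u) (L : List V) : ∀ x z, ChainFrom (Arc G f) x (x :: L) z →
    DistinctNodes f (x :: L) → (∀ c ∈ L, c ≠ u) →
    ∃ W : G.Walk x z, W.IsPath ∧ W.length = 2 * L.length ∧
      (∀ y, y ∈ W.support ↔ y = x ∨ ∃ c ∈ L, y = c ∨ y = f c) ∧
      IsAlternatingWalk h.matching W ∧ (∀ e ∈ W.edges.head?, e ∉ h.matching.edgeSet) ∧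
      {e | e ∈ W.edges ∧ e ∈ h.matching.edgeSet}.ncard = L.length ∧
      (L ≠ [] → h.matching.Adj W.penultimate z) := by
  induction L with
  | nil =>
    intro x z hc _ _
    obtain rfl : x = z := by simpa using hc.2.2
    exact ⟨.nil, by simp [IsAlternatingWalk]⟩
  | cons c L ih =>
    intro x z hc hd hu
    have h1 := List.isChain_cons_cons.1 hc.1
    obtain ⟨hx, hd'⟩ := List.pairwise_cons.1 hd
    obtain ⟨W, w1, w2, w3, w4, w5, w6, w7⟩ := ih c z ⟨h1.2, by simp, by simpa using hc.2.2⟩ hd'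
      fun d hd => hu d (by simp [hd])
    have hcu : c ≠ u := hu c (by simp)
    have hfcu := h.apply_ne_root hcu
    obtain ⟨hxc, hxfc⟩ := hx c (by simp)
    have hc' := (List.pairwise_cons.1 hd').1
    have hA' : G.Adj x (f c) := h1.1
    have hA : G.Adj (f c) c := (h.adj c hcu).symm
    have hfc : f c ∉ W.support := by
      rw [w3]
      rintro (e | ⟨d, hdL, e | e⟩)
      · exact h.apply_ne hcu e
      · exact (hc' d hdL).2 (h.eq_comm.1 e)
      · exact (hc' d hdL).1 (h.inj e)
    have hxW : x ∉ W.support := by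
      rw [w3]
      rintro (e | ⟨d, hdL, e | e⟩)
      · exact hxc e
      · exact (hx d (by simp [hdL])).1 e
      · exact (hx d (by simp [hdL])).2 e
    have hn : s(x, f c) ∉ h.matching.edgeSet := by
      rw [h.mem_matching_edgeSet]; exact fun e => hxc (h.inj e.2)
    have hm : s(f c, c) ∈ h.matching.edgeSet := by
      rw [h.mem_matching_edgeSet]; exact ⟨hfcu, h.inv c⟩
    have hfe : s(f c, c) ∉ W.edges := fun e => hfc (W.fst_mem_support_of_mem_edges e)
    refine ⟨.cons hA' (.cons hA W), ?_, ?_, ?_, ?_, ?_, ?_, fun _ => ?_⟩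
    · rw [SimpleGraph.Walk.cons_isPath_iff, SimpleGraph.Walk.cons_isPath_iff]
      refine ⟨⟨w1, hfc⟩, ?_⟩
      simp only [SimpleGraph.Walk.support_cons, List.mem_cons, not_or]
      exact ⟨hxfc, hxW⟩
    · simp [w2]; omega
    · intro y
      simp only [SimpleGraph.Walk.support_cons, List.mem_cons, w3]
      constructor
      · rintro (e | e | e | ⟨d, hdL, e⟩)
        · exact .inl e
        · exact .inr ⟨c, .inl rfl, .inr e⟩
        · exact .inr ⟨c, .inl rfl, .inl e⟩
        · exact .inr ⟨d, .inr hdL, e⟩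
      · rintro (e | ⟨d, rfl | hdL, e⟩)
        · exact .inl e
        · tauto
        · exact .inr (.inr (.inr ⟨d, hdL, e⟩))
    · simp only [IsAlternatingWalk, SimpleGraph.Walk.edges_cons]
      rw [List.isChain_cons_cons, List.isChain_cons]
      refine ⟨by simp [hn, hm], fun e he => ?_, w4⟩
      simp [hm, w5 e he]
    · simp [hn]
    · have : {e | e ∈ (SimpleGraph.Walk.cons hA' (.cons hA W)).edges ∧
          e ∈ h.matching.edgeSet} =
          insert s(f c, c) {e | e ∈ W.edges ∧ e ∈ h.matching.edgeSet} := by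
        ext e
        simp only [SimpleGraph.Walk.edges_cons, List.mem_cons, Set.mem_ofPred_eq, Set.mem_insert_iff]
        constructor
        · rintro ⟨rfl | rfl | he, hM⟩
          · exact absurd hM hn
          · exact .inl rfl
          · exact .inr ⟨he, hM⟩
        · rintro (rfl | ⟨he, hM⟩)
          · exact ⟨.inr (.inl rfl), hm⟩
          · exact ⟨.inr (.inr he), hM⟩
      rw [this, Set.ncard_insert_of_notMem (fun e => hfe e.1)
        ((List.finite_toSet W.edges).subset fun e he => he.1), w6]
      simp
    · cases L with
      | nil =>
        obtain rfl : c = z := by simpa using hc.2.2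
        obtain rfl : W = .nil := by
          cases W with
          | nil => rfl
          | cons _ _ => simp at w2
        exact ⟨hfcu, h.inv c⟩
      | cons d L =>
        have hW : ¬ W.Nil := by
          rw [← SimpleGraph.Walk.length_eq_zero_iff, w2]; simp
        rw [SimpleGraph.Walk.penultimate_cons_of_not_nil _ _ (by simp),
          SimpleGraph.Walk.penultimate_cons_of_not_nil _ _ hW]
        exact w7 (by simp)

theorem exists_blossom (h : IsMate G f u) {a z : V} {L : List V}
    (hc : ChainFrom (Arc G f) a (a :: L) z) (hd : DistinctNodes f (a :: L))
    (hu : ∀ c ∈ L, c ≠ u) (hza : G.Adj a z) :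
    ∃ C : G.Walk a a, IsBlossom h.matching C ∧
      ∀ y, y ∈ C.support ↔ y = a ∨ ∃ c ∈ L, y = c ∨ y = f c := by
  obtain ⟨W, w1, w2, w3, w4, w5, w6, w7⟩ := exists_walk h L a z hc hd hu
  have hz : z ∈ L := by
    have := hc.end_mem
    simp only [List.mem_cons] at this
    exact this.resolve_left hza.ne'
  have ha := (List.pairwise_cons.1 hd).1
  have hn : s(a, z) ∉ h.matching.edgeSet := by
    rw [h.mem_matching_edgeSet]; exact fun e => (ha z hz).2 (h.eq_comm.1 e.2)
  have hs : ∀ y, y ∈ (SimpleGraph.Walk.cons hza W.reverse).support ↔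
      y = a ∨ ∃ c ∈ L, y = c ∨ y = f c := by
    intro y
    simp only [SimpleGraph.Walk.support_cons, SimpleGraph.Walk.support_reverse, List.mem_cons,
      List.mem_reverse, w3]
    exact ⟨fun e => e.elim .inl id, .inr⟩
  refine ⟨.cons hza W.reverse, ⟨?_, ⟨L.length, by simp [w2], ?_⟩, ?_⟩, hs⟩
  · rw [SimpleGraph.Walk.cons_isCycle_iff]
    -- The closing edge is not an edge of the path: the path has length at least two and meets `a`
    -- only at its start.
    refine ⟨w1.reverse, ?_⟩
    rw [SimpleGraph.Walk.edges_reverse, List.mem_reverse]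
    intro he
    cases L with
    | nil => simp at hz
    | cons c L =>
      have hL : 0 < W.length := by rw [w2]; simp
      cases W with
      | nil => simp at hL
      | cons hA W' =>
        rw [SimpleGraph.Walk.cons_isPath_iff] at w1
        simp only [SimpleGraph.Walk.edges_cons, List.mem_cons] at he
        rcases he with he | he
        · have h5 := w4
          simp only [SimpleGraph.Walk.length_cons, List.length_cons] at w2
          cases W' with
          | nil => simp at w2; omega
          | cons hB W'' =>
            obtain rfl := Sym2.congr_right.1 he
            exact (SimpleGraph.Walk.cons_isPath_iff _ _).1 w1.1 |>.2 W''.end_mem_support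
        · exact w1.2 (W'.fst_mem_support_of_mem_edges he)
  · rw [← w6]
    congr 1
    ext e
    simp only [SimpleGraph.Walk.edges_cons, SimpleGraph.Walk.edges_reverse, List.mem_cons,
      List.mem_reverse, Set.mem_ofPred_eq]
    constructor
    · rintro ⟨rfl | he, hM⟩
      · exact absurd hM hn
      · exact ⟨he, hM⟩
    · exact fun he => ⟨.inr he.1, he.2⟩
  · intro w hw hM
    rw [hs] at hw
    rcases hw with rfl | ⟨c, hcL, rfl | rfl⟩
    · exact hM.adj_sub.ne rfl
    · exact (ha _ hcL).2 (h.eq_comm.1 hM.2)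
    · exact (ha c hcL).1 (h.inj hM.2)

end Walks

end SterboulDeming

/-! ### Consistent sets; flowers and Tposies from chains inside them. -/

namespace SterboulDeming

variable {V : Type*} {G : SimpleGraph V} {f : V → V} {u : V} {Y : Set V}

/-- No two members of `Y` are matched to each other. -/
def Consistent (f : V → V) (u : V) (Y : Set V) : Prop := ∀ y ∈ Y, f y ∈ Y → y = u

/-- The implication relation inside `Y`. -/
def Step (G : SimpleGraph V) (f : V → V) (u : V) (Y : Set V) (x z : V) : Prop :=
  x ∈ Y ∧ z ∈ Y ∧ z ≠ u ∧ Arc G f x z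

theorem Step.arc {x z : V} (h : Step G f u Y x z) : Arc G f x z := h.2.2.2

theorem Step.mono {Z : Set V} (hYZ : Y ⊆ Z) {x z : V} (h : Step G f u Y x z) :
    Step G f u Z x z := ⟨hYZ h.1, hYZ h.2.1, h.2.2⟩

theorem ChainFrom.arc {a b : V} {l : List V} (h : ChainFrom (Step G f u Y) a l b) :
    ChainFrom (Arc G f) a l b := h.mono fun _ _ _ _ => Step.arc

theorem ChainFrom.mem_of_cons {a a' b : V} {l : List V}
    (h : ChainFrom (Step G f u Y) a (a' :: l) b) : ∀ y ∈ l, y ∈ Y ∧ y ≠ u := by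
  obtain ⟨h, -⟩ := h
  induction l generalizing a' with
  | nil => simp
  | cons c l ih =>
    have h1 := List.isChain_cons_cons.1 h
    simp only [List.mem_cons, forall_eq_or_imp]
    exact ⟨⟨h1.1.2.1, h1.1.2.2.1⟩, ih h1.2⟩

theorem ChainFrom.mem_of_concat {a c b : V} {l : List V}
    (h : ChainFrom (Step G f u Y) a (l ++ [c]) b) : ∀ y ∈ l, y ∈ Y := by
  intro y hy
  obtain ⟨s, t, rfl⟩ := List.append_of_mem hy
  cases t with
  | nil =>
    have h1 := List.isChain_split.1 (show List.IsChain _ (s ++ y :: [c]) by simpa using h.1)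
    exact (List.isChain_cons_cons.1 h1.2).1.1
  | cons d t =>
    have h1 := List.isChain_split.1
      (show List.IsChain _ (s ++ y :: (d :: t ++ [c])) by simpa using h.1)
    exact (List.isChain_cons_cons.1 h1.2).1.1

theorem DistinctNodes.of_consistent (h : IsMate G f u) (hY : Consistent f u Y) {L : List V}
    (hL : L.Nodup) (hLY : ∀ y ∈ L, y ∈ Y) : DistinctNodes f L := by
  refine (hL : L.Pairwise (· ≠ ·)).imp_of_mem ?_
  intro x y hx hy hxy
  refine ⟨hxy, fun e => hxy ?_⟩
  obtain rfl : y = u := hY y (hLY y hy) (e ▸ hLY x hx)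
  rw [e, h.fix]

theorem DistinctNodes.reverse_map (h : IsMate G f u) {L : List V} (hL : DistinctNodes f L) :
    DistinctNodes f (L.map f).reverse := by
  unfold DistinctNodes at *
  rw [List.pairwise_reverse, List.pairwise_map]
  refine hL.imp ?_
  rintro x y ⟨h1, h2⟩
  refine ⟨fun e => h1 (h.inj e).symm, fun e => h2 ?_⟩
  rw [h.inv] at e; exact e.symm

theorem DistinctNodes.append_reverse_map (h : IsMate G f u) {A B : List V}
    (hd : DistinctNodes f (A ++ B)) : DistinctNodes f (A ++ (B.map f).reverse) := by
  have := List.pairwise_append.1 hd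
  refine List.pairwise_append.2 ⟨this.1, DistinctNodes.reverse_map h this.2.1, ?_⟩
  simp only [List.mem_reverse, List.mem_map]
  rintro x hx _ ⟨y, hy, rfl⟩
  rw [h.inv]
  exact (this.2.2 x hx y hy).symm

theorem ChainFrom.reverse_map (h : IsMate G f u) {a b : V} {l : List V}
    (hc : ChainFrom (Arc G f) a l b) : ChainFrom (Arc G f) (f b) (l.map f).reverse (f a) :=
  (hc.map (t := fun x y => Arc G f y x) f fun _ _ _ _ => h.arc_conj).reverse

/-- Two branches leaving a common base and joined by an edge close up to a blossom. -/
theorem exists_blossom_of_branches (h : IsMate G f u) {p a b : V} {A B : List V}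
    (hA : ChainFrom (Arc G f) p (p :: A) a) (hB : ChainFrom (Arc G f) p (p :: B) b)
    (hab : G.Adj a b) (hd : DistinctNodes f (p :: A ++ B)) (hu : ∀ c ∈ A ++ B, c ≠ u) :
    ∃ C : G.Walk p p, IsBlossom h.matching C ∧
      ∀ y, y ∈ C.support ↔ y = p ∨ ∃ c ∈ A ++ B, y = c ∨ y = f c := by
  -- Around the cycle the second branch is traversed backwards, that is, as its conjugate.
  have hd' : DistinctNodes f (p :: (A ++ (B.map f).reverse)) :=
    DistinctNodes.append_reverse_map (A := p :: A) h hd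
  have hu' : ∀ c ∈ A ++ (B.map f).reverse, c ≠ u := by
    intro c hc
    simp only [List.mem_append, List.mem_reverse, List.mem_map] at hc
    rcases hc with hc | ⟨c, hc, rfl⟩
    · exact hu c (by simp [hc])
    · exact h.apply_ne_root (hu c (by simp [hc]))
  have key : ∃ z, G.Adj p z ∧ ChainFrom (Arc G f) p (p :: (A ++ (B.map f).reverse)) z := by
    cases B with
    | nil =>
      obtain rfl : p = b := by simpa using hB.2.2
      exact ⟨a, hab.symm, by simpa using hA⟩
    | cons c B =>
      have h1 := List.isChain_cons_cons.1 hB.1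
      refine ⟨f c, h1.1, ?_⟩
      have h2 : ChainFrom (Arc G f) c (c :: B) b := ⟨h1.2, by simp, by simpa using hB.2.2⟩
      have h3 := h2.reverse_map h
      have h4 : Arc G f a (f b) := by unfold Arc; rwa [h.inv]
      exact hA.append h4 h3
  obtain ⟨z, hz, hc⟩ := key
  obtain ⟨C, hC, hs⟩ := exists_blossom h hc hd' hu' hz
  refine ⟨C, hC, fun y => ?_⟩
  rw [hs]
  simp only [List.mem_append, List.mem_reverse, List.mem_map, or_and_right, exists_or]
  refine or_congr_right (or_congr_right ⟨?_, ?_⟩)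
  · rintro ⟨_, ⟨c, hc, rfl⟩, e⟩
    rw [h.inv] at e
    exact ⟨c, hc, e.symm⟩
  · rintro ⟨c, hc, e⟩
    refine ⟨f c, ⟨c, hc, rfl⟩, ?_⟩
    rw [h.inv]; exact e.symm

/-- A closed implication walk from `a` to its partner closes up to a blossom with base `a`. -/
theorem exists_blossom_of_closed (h : IsMate G f u) {a : V} {L : List V}
    (hc : ChainFrom (Arc G f) a (a :: L ++ [f a]) (f a)) (hd : DistinctNodes f (a :: L))
    (hu : ∀ c ∈ L, c ≠ u) :
    ∃ C : G.Walk a a, IsBlossom h.matching C ∧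
      ∀ y, y ∈ C.support ↔ y = a ∨ ∃ c ∈ L, y = c ∨ y = f c := by
  obtain ⟨d, h1, h2, -⟩ := ChainFrom.join_iff.1 ⟨hc, by simp⟩
  refine exists_blossom h h1 hd hu ?_
  unfold Arc at h2
  rw [h.inv] at h2
  exact h2.symm

/-- Let `p` be the last vertex of `P` on a walk from `u` to `b₂`. The two branches from `p` to `b₁`
and `b₂` with the edge between them form a blossom based at `p`, and `P` up to `p` is the stem. -/
theorem memFlower_of_chain (h : IsMate G f u) (hY : Consistent f u Y) (huY : u ∈ Y)
    {b₁ b₂ : V} {P : List V} (hP : ChainFrom (Step G f u Y) u P b₁) (hPn : P.Nodup)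
    (hb₂ : Relation.ReflTransGen (Step G f u Y) u b₂) (hb : G.Adj b₁ b₂) {x : V}
    (hx : x ∈ P ∨ f x ∈ P) : MemFlower h.matching x := by
  obtain ⟨p, hpP, η, hη, hηn, hηP, -⟩ := exists_last_exit (S := {y | y ∈ P}) hb₂ hP.start_mem
  obtain ⟨A, B, rfl⟩ := List.append_of_mem hpP
  obtain ⟨hA, hB⟩ := ChainFrom.split_iff.1 hP
  have hBu := hB.mem_of_cons
  have hηu := hη.mem_of_cons
  obtain ⟨T, hT⟩ : ∃ T, A ++ [p] = u :: T := by
    have h1 := hA.2.1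
    cases hE : A ++ [p] with
    | nil => simp at hE
    | cons c T => rw [hE] at h1; exact ⟨T, by simpa using h1⟩
  rw [hT] at hA
  have hTu := hA.mem_of_cons
  have hpY : p ∈ Y := by
    have : p ∈ u :: T := by rw [← hT]; simp
    rcases List.mem_cons.1 this with rfl | h1
    · exact huY
    · exact (hTu p h1).1
  have hPn' : (u :: T ++ B).Nodup := by rw [← hT]; simpa using hPn
  have hd1 : DistinctNodes f (p :: B ++ η) := by
    refine DistinctNodes.of_consistent h hY ?_ ?_
    · have h2 : (p :: B).Nodup := (List.nodup_append.1 hPn).2.1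
      refine List.nodup_append.2 ⟨h2, (List.nodup_cons.1 hηn).2, ?_⟩
      rintro y hy z hz rfl
      exact hηP y hz (List.mem_append_right _ hy)
    · simp only [List.cons_append, List.mem_cons, List.mem_append]
      rintro y (rfl | hy | hy)
      exacts [hpY, (hBu y hy).1, (hηu y hy).1]
  have hd2 : DistinctNodes f (u :: T) := by
    refine DistinctNodes.of_consistent h hY (List.nodup_append.1 hPn').1 ?_
    simp only [List.mem_cons]
    rintro y (rfl | hy)
    exacts [huY, (hTu y hy).1]
  have hBη : ∀ c ∈ B ++ η, c ∈ Y ∧ c ≠ u ∧ c ∉ u :: T := by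
    intro c hc
    rcases List.mem_append.1 hc with hc | hc
    · refine ⟨(hBu c hc).1, (hBu c hc).2, fun hcT => ?_⟩
      exact (List.nodup_append.1 hPn').2.2 c hcT c hc rfl
    · refine ⟨(hηu c hc).1, (hηu c hc).2, fun hcT => hηP c hc ?_⟩
      rw [← hT] at hcT
      simp only [List.mem_append, List.mem_singleton] at hcT
      simp only [Set.mem_ofPred_eq, List.mem_append, List.mem_cons]
      tauto
  obtain ⟨C, hC, hCs⟩ := exists_blossom_of_branches h hB.arc hη.arc hb hd1
    fun c hc => (hBη c hc).2.1
  obtain ⟨W, w1, w2, w3, w4, w5, w6, w7⟩ := exists_walk h T u p hA.arc hd2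
    fun c hc => (hTu c hc).2
  refine ⟨p, u, C, W.reverse, ⟨hC, w1.reverse, ?_, by simp [w2], fun e => e rfl, ?_⟩, ?_⟩
  · rw [IsAlternatingWalk, SimpleGraph.Walk.edges_reverse, List.isChain_reverse]
    exact w4.imp fun a b hab => by tauto
  · intro y hyC hyW
    rw [SimpleGraph.Walk.support_reverse, List.mem_reverse, w3] at hyW
    rw [hCs] at hyC
    by_contra hyp
    obtain ⟨c, hc, hyc⟩ := hyC.resolve_left hyp
    obtain ⟨hcY, hcu, hcT⟩ := hBη c hc
    rcases hyW with rfl | ⟨d, hdT, hyd⟩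
    · rcases hyc with e | e
      · exact hcu e.symm
      · exact h.apply_ne_root hcu e.symm
    · have hd := hTu d hdT
      rcases hyc with rfl | rfl <;> rcases hyd with e | e
      · exact hcT (e ▸ List.mem_cons_of_mem _ hdT)
      · exact hd.2 (hY d hd.1 (e ▸ hcY))
      · exact hcu (hY c hcY (e ▸ hd.1))
      · exact hcT (h.inj e ▸ List.mem_cons_of_mem _ hdT)
  · have key : ∀ w ∈ u :: T ++ B, ∀ x, x = w ∨ x = f w → x ∈ C.support ∨ x ∈ W.reverse.support := by
      intro w hw x hx
      rw [SimpleGraph.Walk.support_reverse, List.mem_reverse, w3, hCs]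
      simp only [List.cons_append, List.mem_cons, List.mem_append] at hw
      rcases hw with rfl | hw | hw
      · right; left
        rcases hx with e | e
        · exact e
        · rw [e, h.fix]
      · exact .inr (.inr ⟨w, hw, hx⟩)
      · exact .inl (.inr ⟨w, by simp [hw], hx⟩)
    have e : A ++ p :: B = u :: T ++ B := by rw [← hT]; simp
    rw [e] at hx
    rcases hx with hx | hx
    · exact key x hx x (.inl rfl)
    · exact key (f x) hx x (.inr (h.inv x).symm)

/-- The second blossom is based at the last exit `p` from `P` towards `b₂`. Let `t` be the first
vertex of the part of `P` up to `p` that a walk from `y₂` to `p` meets. Going back from `f t` along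
the conjugate of `P` to `f y₁`, through `R` to `y₂`, and on to `t` closes the first blossom, based
at `f t`. The path is `f t`, `t`, then `P` up to `p`. Thus `P` is covered in three pieces. -/
theorem memTposy_of_chain (h : IsMate G f u) (hY : Consistent f u Y) (huY : u ∉ Y)
    {y₁ y₂ b₁ b₂ x : V} {P R : List V} (hP : ChainFrom (Step G f u Y) y₁ P b₁) (hPn : P.Nodup)
    (hPY : ∀ y ∈ P, y ∈ Y) (hR : ChainFrom (Arc G f) (f y₁) (f y₁ :: R ++ [y₂]) y₂)
    (hRd : DistinctNodes f R) (hRY : ∀ r ∈ R, r ≠ u ∧ r ∉ Y ∧ f r ∉ Y) (hx : x ∈ P)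
    (hyx : Relation.ReflTransGen (Step G f u Y) y₂ x)
    (hxb : Relation.ReflTransGen (Step G f u Y) x b₂) (hb : G.Adj b₁ b₂) {w : V} (hw : w ∈ P) :
    MemTposy h.matching w := by
  have hYf : ∀ y ∈ Y, f y ∉ Y := fun y hy hfy => huY (hY y hy hfy ▸ hy)
  obtain ⟨p, hpP, η, hη, hηn, hηP, hxp⟩ := exists_last_exit (S := {y | y ∈ P}) hxb hx
  obtain ⟨A, B, rfl⟩ := List.append_of_mem hpP
  obtain ⟨hA, hB⟩ := ChainFrom.split_iff.1 hP
  obtain ⟨t, htA, θ, hθ, hθn, hθA⟩ := exists_first_entry (S := {y | y ∈ A ++ [p]})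
    (hyx.trans hxp) (by simp)
  obtain ⟨Q, T, hQT⟩ := List.append_of_mem htA
  rw [hQT] at hA
  obtain ⟨hQ, hT⟩ := ChainFrom.split_iff.1 hA
  have hηu := hη.mem_of_cons
  have hθY := hθ.mem_of_concat
  have hPe : A ++ p :: B = Q ++ t :: T ++ B := by rw [← hQT]; simp
  have hPn' : (Q ++ t :: T ++ B).Nodup := hPe ▸ hPn
  have hpT : p ∈ t :: T := hT.end_mem
  have hmem : ∀ y, y ∈ A ++ p :: B ↔ y ∈ Q ∨ y ∈ t :: T ∨ y ∈ B := by
    intro y; rw [hPe]; simp only [List.mem_append, or_assoc]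
  have hQY : ∀ y ∈ Q, y ∈ Y := fun y hy => hPY y ((hmem y).2 (.inl hy))
  have hTY : ∀ y ∈ t :: T, y ∈ Y := fun y hy => hPY y ((hmem y).2 (.inr (.inl hy)))
  have hBY : ∀ y ∈ B, y ∈ Y := fun y hy => hPY y ((hmem y).2 (.inr (.inr hy)))
  have hQT' : ∀ y ∈ Q, y ∉ t :: T := fun y hy hy' =>
    (List.nodup_append.1 (List.nodup_append.1 hPn').1).2.2 y hy y hy' rfl
  have hTn : (t :: T).Nodup := (List.nodup_append.1 (List.nodup_append.1 hPn').1).2.1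
  have hB' : ∀ y ∈ B, y ∉ Q ++ t :: T := fun y hy hy' =>
    (List.nodup_append.1 hPn').2.2 y hy' y hy rfl
  have hθ' : ∀ y ∈ θ, y ∉ Q ++ t :: T := fun y hy hy' => hθA y hy (by
    rw [← hQT] at hy'; exact hy')
  have hη' : ∀ y ∈ η, y ∉ Q ++ t :: T := fun y hy hy' => hηP y hy (by
    simp only [Set.mem_ofPred_eq, hmem]; simp only [List.mem_append] at hy'; tauto)
  have hd1 : DistinctNodes f (p :: B ++ η) := by
    refine DistinctNodes.of_consistent h hY ?_ ?_
    · have h2 : (p :: B).Nodup := (List.nodup_append.1 hPn).2.1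
      refine List.nodup_append.2 ⟨h2, (List.nodup_cons.1 hηn).2, ?_⟩
      rintro y hy z hz rfl
      exact hηP y hz (List.mem_append_right _ hy)
    · simp only [List.cons_append, List.mem_cons, List.mem_append]
      rintro y (rfl | hy | hy)
      exacts [hTY _ hpT, hBY y hy, (hηu y hy).1]
  have hne : ∀ c ∈ Y, c ≠ u := fun c hc e => huY (e ▸ hc)
  obtain ⟨C₂, hC₂, hC₂s⟩ := exists_blossom_of_branches h hB.arc hη.arc hb hd1 (by
    intro c hc
    rcases List.mem_append.1 hc with hc | hc
    exacts [hne c (hBY c hc), (hηu c hc).2])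
  -- the blossom closed by `R`
  have hchain : ChainFrom (Arc G f) (f t) (f t :: ((Q.map f).reverse ++ R ++ θ) ++ [t]) t := by
    have h1 := hQ.arc.reverse_map h
    have e1 : ((Q ++ [t]).map f).reverse = f t :: (Q.map f).reverse := by simp
    rw [e1] at h1
    obtain ⟨X, hX⟩ : ∃ X, f t :: (Q.map f).reverse = X ++ [f y₁] :=
      ⟨_, (List.dropLast_append_getLast? _ h1.2.2).symm⟩
    rw [hX] at h1
    obtain ⟨X', hX'⟩ : ∃ X', θ ++ [t] = y₂ :: X' := by
      have h1 := hθ.2.1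
      cases hE : θ ++ [t] with
      | nil => simp at hE
      | cons c T => rw [hE] at h1; exact ⟨T, by simpa using h1⟩
    have h2 : ChainFrom (Arc G f) (f y₁) (f y₁ :: R ++ y₂ :: X') t :=
      ChainFrom.split_iff.2 ⟨hR, hX' ▸ hθ.arc⟩
    have h3 := ChainFrom.split_iff.2 ⟨h1, h2⟩
    have e2 : f t :: ((Q.map f).reverse ++ R ++ θ) ++ [t] = X ++ f y₁ :: (R ++ y₂ :: X') := by
      have : f t :: ((Q.map f).reverse ++ R ++ θ) ++ [t] =
        (f t :: (Q.map f).reverse) ++ (R ++ (θ ++ [t])) := by simp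
      rw [this, hX, hX']; simp
    rw [e2]; exact h3
  have hd2 : DistinctNodes f (f t :: ((Q.map f).reverse ++ R ++ θ)) := by
    have e3 : f t :: ((Q.map f).reverse ++ R ++ θ) = ((Q ++ [t]).map f).reverse ++ (R ++ θ) := by
      simp
    have hQtY : ∀ y ∈ Q ++ [t], y ∈ Y := by
      simp only [List.mem_append, List.mem_singleton]
      rintro y (hy | rfl)
      exacts [hQY y hy, hTY _ (by simp)]
    have hQtn : (Q ++ [t]).Nodup := by
      have := (List.nodup_append.1 hPn').1
      rw [List.append_cons] at this
      exact (List.nodup_append.1 this).1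
    rw [e3]
    refine List.pairwise_append.2 ⟨DistinctNodes.reverse_map h
      (DistinctNodes.of_consistent h hY hQtn hQtY), List.pairwise_append.2 ⟨hRd,
        DistinctNodes.of_consistent h hY (List.nodup_append.1 hθn).1 hθY, ?_⟩, ?_⟩
    · intro r hr y hy
      refine ⟨fun e => (hRY r hr).2.1 (e ▸ hθY y hy), fun e => (hRY r hr).2.2 ?_⟩
      rw [e, h.inv]; exact hθY y hy
    · simp only [List.mem_reverse, List.mem_map]
      rintro _ ⟨q, hq, rfl⟩ z hz
      have hqY := hQtY q hq
      rcases List.mem_append.1 hz with hz | hz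
      · refine ⟨fun e => (hRY z hz).2.2 ?_, fun e => (hRY z hz).2.1 (h.inj e ▸ hqY)⟩
        rw [← e, h.inv]; exact hqY
      · refine ⟨fun e => hYf q hqY (e ▸ hθY z hz), fun e => hθ' z hz ?_⟩
        rw [← h.inj e]
        simp only [List.mem_append, List.mem_cons] at hq ⊢
        tauto
  have hL : ∀ c ∈ (Q.map f).reverse ++ R ++ θ, c ≠ u := by
    simp only [List.mem_append, List.mem_reverse, List.mem_map]
    rintro _ ((⟨c, hc, rfl⟩ | hc) | hc)
    exacts [h.apply_ne_root (hne c (hQY c hc)), (hRY _ hc).1, hne _ (hθY _ hc)]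
  obtain ⟨C₁, hC₁, hC₁s⟩ := exists_blossom_of_closed h (a := f t)
    (L := (Q.map f).reverse ++ R ++ θ) (by rw [h.inv]; exact hchain) hd2 hL
  have hTn' : DistinctNodes f (t :: T) := DistinctNodes.of_consistent h hY hTn hTY
  obtain ⟨W, w1, w2, w3, w4, w5, w6, w7⟩ := exists_walk h T t p hT.arc hTn'
    fun c hc => hne c (hTY c (by simp [hc]))
  have htY : t ∈ Y := hTY t (by simp)
  have htu : t ≠ u := hne t htY
  have hA' : G.Adj (f t) t := (h.adj t htu).symm
  have hftW : f t ∉ W.support := by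
    rw [w3]
    have := List.pairwise_cons.1 hTn'
    rintro (e | ⟨c, hc, e | e⟩)
    · exact h.apply_ne htu e
    · exact (this.1 c hc).2 (h.eq_comm.1 e)
    · exact (this.1 c hc).1 (h.inj e)
  have hM : h.matching.Adj (f t) t := ⟨h.apply_ne_root htu, h.inv t⟩
  -- members of the path versus members of the first blossom
  have hC₁T : ∀ c ∈ t :: T, c ∉ C₁.support ∧ (c ≠ t → f c ∉ C₁.support) := by
    intro c hc
    have hcY := hTY c hc
    simp only [hC₁s, List.mem_append, List.mem_reverse, List.mem_map, not_or, not_exists, not_and]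
    refine ⟨⟨fun e => hYf t htY (e ▸ hcY), fun d hd => ?_⟩, fun hct =>
      ⟨fun e => hct (h.inj e), fun d hd => ?_⟩⟩
    · rcases hd with (⟨q, hq, rfl⟩ | hd) | hd
      · refine ⟨fun e => hYf q (hQY q hq) (e ▸ hcY), fun e => hQT' q hq ?_⟩
        rw [h.inv] at e; exact e ▸ hc
      · exact ⟨fun e => (hRY d hd).2.1 (e ▸ hcY), fun e => (hRY d hd).2.2 (e ▸ hcY)⟩
      · refine ⟨fun e => hθ' d hd (List.mem_append_right _ (e ▸ hc)), fun e => ?_⟩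
        exact hYf d (hθY d hd) (e ▸ hcY)
    · rcases hd with (⟨q, hq, rfl⟩ | hd) | hd
      · refine ⟨fun e => hQT' q hq (h.inj e ▸ hc), fun e => ?_⟩
        rw [h.inv] at e; exact hYf c hcY (e ▸ hQY q hq)
      · refine ⟨fun e => (hRY d hd).2.2 ?_, fun e => (hRY d hd).2.1 (h.inj e ▸ hcY)⟩
        rw [← e, h.inv]; exact hcY
      · refine ⟨fun e => hYf c hcY (e ▸ hθY d hd), fun e => ?_⟩
        exact hθ' d hd (List.mem_append_right _ (h.inj e ▸ hc))
  have hC₂T : ∀ c ∈ t :: T, (c ≠ p → c ∉ C₂.support) ∧ f c ∉ C₂.support := by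
    intro c hc
    have hcY := hTY c hc
    have hBη : ∀ d ∈ B ++ η, d ∈ Y ∧ d ∉ Q ++ t :: T := by
      intro d hd
      rcases List.mem_append.1 hd with hd | hd
      exacts [⟨hBY d hd, hB' d hd⟩, ⟨(hηu d hd).1, hη' d hd⟩]
    simp only [hC₂s, not_or, not_exists, not_and]
    refine ⟨fun hcp => ⟨hcp, fun d hd => ⟨fun e => ?_, fun e => ?_⟩⟩,
      fun e => hYf c hcY (e ▸ hTY p hpT), fun d hd => ⟨fun e => ?_, fun e => ?_⟩⟩
    · exact (hBη d hd).2 (List.mem_append_right _ (e ▸ hc))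
    · exact hYf d (hBη d hd).1 (e ▸ hcY)
    · exact hYf c hcY (e ▸ (hBη d hd).1)
    · exact (hBη d hd).2 (List.mem_append_right _ (h.inj e ▸ hc))
  refine ⟨f t, p, C₁, C₂, .cons hA' W, ⟨⟨hC₁, hC₂, ?_, ?_, ?_, ?_, ?_, ?_⟩, ?_⟩, ?_⟩
  -- The blossoms may overlap, but the base `p` of the second is not on the first.
  · intro e
    have h1 : p ∈ C₂.toSubgraph.verts := by
      rw [SimpleGraph.Walk.verts_toSubgraph]; exact C₂.start_mem_support
    rw [← e, SimpleGraph.Walk.verts_toSubgraph] at h1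
    exact (hC₁T p hpT).1 h1
  · exact (SimpleGraph.Walk.cons_isPath_iff _ _).2 ⟨w1, hftW⟩
  · rw [IsAlternatingWalk, SimpleGraph.Walk.edges_cons, List.isChain_cons]
    exact ⟨fun e he => by simp [h.mem_matching_edgeSet.2 hM, w5 e he], w4⟩
  · simp [w2]
  · simpa using hM
  · rcases T.eq_nil_or_concat with rfl | ⟨T', d, rfl⟩
    · obtain rfl : t = p := by simpa using hT.2.2
      obtain rfl : W = .nil := by
        cases W with
        | nil => rfl
        | cons _ _ => simp at w2
      exact hM
    · have hW : ¬ W.Nil := by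
        rw [← SimpleGraph.Walk.length_eq_zero_iff, w2]; simp
      rw [SimpleGraph.Walk.penultimate_cons_of_not_nil _ _ hW]
      exact w7 (by simp)
  · intro y hy hyt hyp
    simp only [SimpleGraph.Walk.support_cons, List.mem_cons, w3] at hy
    rcases hy.resolve_left hyt with rfl | ⟨c, hc, rfl | rfl⟩
    · exact ⟨(hC₁T y (by simp)).1, (hC₂T y (by simp)).1 hyp⟩
    · exact ⟨(hC₁T y (by simp [hc])).1, (hC₂T y (by simp [hc])).1 hyp⟩
    · exact ⟨(hC₁T c (by simp [hc])).2 fun e => hyt (e ▸ rfl), (hC₂T c (by simp [hc])).2⟩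
  · rcases (hmem w).1 hw with hw | hw | hw
    · refine .inl ((hC₁s w).2 (.inr ⟨f w, ?_, .inr (h.inv w).symm⟩))
      simp only [List.mem_append, List.mem_reverse, List.mem_map]
      exact .inl (.inl ⟨w, hw, rfl⟩)
    · refine .inr (.inr ?_)
      simp only [SimpleGraph.Walk.support_cons, List.mem_cons, w3]
      rcases List.mem_cons.1 hw with rfl | hw
      · exact .inr (.inl rfl)
      · exact .inr (.inr ⟨w, hw, .inl rfl⟩)
    · exact .inr (.inl ((hC₂s w).2 (.inr ⟨w, by simp [hw], .inl rfl⟩)))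

end SterboulDeming

/-! ### Changing the matching inside a consistent set. -/

namespace SterboulDeming

variable {V : Type*} {G : SimpleGraph V} {f f' f'' : V → V} {u : V} {Y : Set V}

/-- `f'` is obtained from `f` by rematching the consistent set `Y` with its partners. -/
structure Rematch (G : SimpleGraph V) (f f' : V → V) (u : V) (Y : Set V) : Prop where
  mate : IsMate G f' u
  consistent : Consistent f' u Y
  reach : ∀ x z, Relation.ReflTransGen (Step G f u Y) x z →
    Relation.ReflTransGen (Step G f' u Y) x z
  swap : ∀ y ∈ Y, Relation.ReflTransGen (Step G f' u Y) (f' (f y)) y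
  off : ∀ x, x ∉ Y → f x ∉ Y → f' x = f x
  on : ∀ x, f x ∈ Y → f' x ∈ Y

theorem Rematch.refl (h : IsMate G f u) (hY : Consistent f u Y) : Rematch G f f u Y where
  mate := h
  consistent := hY
  reach _ _ := id
  swap y _ := by rw [h.inv]
  off _ _ _ := rfl
  on _ := id

theorem Rematch.trans (h : IsMate G f u) (h₁ : Rematch G f f' u Y) (h₂ : Rematch G f' f'' u Y) :
    Rematch G f f'' u Y where
  mate := h₂.mate
  consistent := h₂.consistent
  reach x z hxz := h₂.reach x z (h₁.reach x z hxz)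
  swap y hy := by
    have hz : f' (f y) ∈ Y := h₁.on (f y) (by rwa [h.inv])
    have h3 := h₂.swap _ hz
    rw [h₁.mate.inv] at h3
    exact h3.trans (h₂.reach _ _ (h₁.swap y hy))
  off x hx hfx := by
    have h3 := h₁.off x hx hfx
    rw [h₂.off x hx (by rwa [h3]), h3]
  on x hx := h₂.on x (h₁.on x hx)

/-- Rotating the partners of a consistent set along a permutation. -/
theorem exists_rematch_of_perm [Finite V] (h : IsMate G f u) (hY : Consistent f u Y)
    (ρ : Equiv.Perm V) (hρY : ∀ x, x ∉ Y → ρ x = x) (hρu : ρ u = u)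
    (hρ : ∀ c ∈ Y, c ≠ u → G.Adj c (f (ρ c))) :
    ∃ f', Rematch G f f' u Y ∧ (∀ x ∈ Y, f' x = f (ρ x)) ∧ ∀ x, f x ∈ Y → f' x = ρ⁻¹ (f x) := by
  classical
  have hai : ∀ x, ρ (ρ⁻¹ x) = x := fun x => ρ.apply_symm_apply x
  have hia : ∀ x, ρ⁻¹ (ρ x) = x := fun x => ρ.symm_apply_apply x
  have hmem : ∀ x, ρ x ∈ Y ↔ x ∈ Y := fun x => by
    by_cases hx : x ∈ Y
    · refine ⟨fun _ => hx, fun _ => ?_⟩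
      by_contra h1
      have := ρ.injective (hρY _ h1)
      exact h1 (by rwa [this])
    · rw [hρY x hx]
  have hmem' : ∀ x, ρ⁻¹ x ∈ Y ↔ x ∈ Y := fun x => by rw [← hmem, hai]
  have hinvY : ∀ x, x ∉ Y → ρ⁻¹ x = x := fun x hx => by rw [Equiv.Perm.inv_eq_iff_eq, hρY x hx]
  have hinvu : ρ⁻¹ u = u := by rw [Equiv.Perm.inv_eq_iff_eq, hρu]
  have hne : ∀ x, ρ x ≠ u ↔ x ≠ u := fun x => by
    rw [not_iff_not]; exact ⟨fun e => ρ.injective (e.trans hρu.symm), fun e => by rw [e, hρu]⟩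
  have hne' : ∀ x, ρ⁻¹ x ≠ u ↔ x ≠ u := fun x => by rw [← hne, hai]
  set g : V → V := fun x => if x ∈ Y then f (ρ x) else ρ⁻¹ (f x) with hg
  have g1 : ∀ x ∈ Y, g x = f (ρ x) := fun x hx => by simp [hg, hx]
  have g0 : ∀ x, x ∉ Y → g x = ρ⁻¹ (f x) := fun x hx => by simp [hg, hx]
  have hgu : g u = u := by
    by_cases hu : u ∈ Y
    · rw [g1 u hu, hρu, h.fix]
    · rw [g0 u hu, h.fix, hinvu]
  have g2 : ∀ x, f x ∈ Y → g x = ρ⁻¹ (f x) := fun x hx => by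
    by_cases hxY : x ∈ Y
    · obtain rfl : x = u := hY x hxY hx
      rw [hgu, h.fix, hinvu]
    · exact g0 x hxY
  have hnot : ∀ x ∈ Y, x ≠ u → f x ∉ Y := fun x hx hxu hfx => hxu (hY x hx hfx)
  have hmate : IsMate G g u := by
    refine ⟨fun x => ?_, fun x hxu => ?_, hgu⟩
    · by_cases hxu : x = u
      · rw [hxu, hgu, hgu]
      by_cases hx : x ∈ Y
      · rw [g1 x hx, g0 _ (hnot _ ((hmem x).2 hx) ((hne x).2 hxu)), h.inv,
          hia]
      · rw [g0 x hx]
        by_cases hfx : f x ∈ Y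
        · rw [g1 _ ((hmem' _).2 hfx), hai, h.inv]
        · rw [hinvY _ hfx, g0 _ hfx, h.inv, hinvY x hx]
    · by_cases hx : x ∈ Y
      · rw [g1 x hx]; exact hρ x hx hxu
      · rw [g0 x hx]
        by_cases hfx : f x ∈ Y
        · have := hρ _ ((hmem' _).2 hfx) ((hne' _).2 (h.apply_ne_root hxu))
          rw [hai, h.inv] at this
          exact this.symm
        · rw [hinvY _ hfx]; exact h.adj x hxu
  have hstep : ∀ c ∈ Y, c ≠ u → Step G g u Y c (ρ⁻¹ c) := by
    intro c hc hcu
    refine ⟨hc, (hmem' c).2 hc, (hne' c).2 hcu, ?_⟩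
    unfold Arc
    rw [g1 _ ((hmem' c).2 hc), hai]
    exact h.adj c hcu
  have hback : ∀ c ∈ Y, c ≠ u → Relation.ReflTransGen (Step G g u Y) (ρ⁻¹ c) c := by
    intro c hc hcu
    have hpow : ∀ n : ℕ, ((ρ⁻¹ ^ n) (ρ⁻¹ c) ∈ Y ∧ (ρ⁻¹ ^ n) (ρ⁻¹ c) ≠ u) ∧
        Relation.ReflTransGen (Step G g u Y) (ρ⁻¹ c) ((ρ⁻¹ ^ n) (ρ⁻¹ c)) := by
      intro n
      induction n with
      | zero => exact ⟨⟨(hmem' c).2 hc, (hne' c).2 hcu⟩, .refl⟩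
      | succ n ih =>
        rw [pow_succ', Equiv.Perm.mul_apply]
        exact ⟨⟨(hmem' _).2 ih.1.1, (hne' _).2 ih.1.2⟩,
          ih.2.tail (hstep _ ih.1.1 ih.1.2)⟩
    have h1 := (hpow (orderOf ρ⁻¹ - 1)).2
    -- New arcs run from `c` to `ρ⁻¹ c`; following them around the finite cycle returns to `c`.
    have h2 : (ρ⁻¹ ^ (orderOf ρ⁻¹ - 1)) (ρ⁻¹ c) = c := by
      rw [← Equiv.Perm.mul_apply, ← pow_succ, Nat.sub_add_cancel (orderOf_pos _), pow_orderOf_eq_one,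
        Equiv.Perm.one_apply]
    rwa [h2] at h1
  refine ⟨g, ⟨hmate, ?_, ?_, ?_, ?_, ?_⟩, g1, g2⟩
  · intro y hy hgy
    by_contra hyu
    rw [g1 y hy] at hgy
    exact hnot _ ((hmem y).2 hy) ((hne y).2 hyu) hgy
  · intro x z hxz
    induction hxz with
    | refl => exact .refl
    | @tail b c _ hst ih =>
      -- The old arc from `b` to `c` now ends in `ρ⁻¹ c`, the new partner of `f c`, and the cycle
      -- leads from there to `c`.
      refine (ih.tail ?_).trans (hback c hst.2.1 hst.2.2.1)
      refine ⟨hst.1, (hmem' c).2 hst.2.1, (hne' c).2 hst.2.2.1, ?_⟩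
      unfold Arc
      rw [g1 _ ((hmem' c).2 hst.2.1), hai]
      exact hst.2.2.2
  · intro y hy
    rw [g2 (f y) (by rwa [h.inv]), h.inv]
    by_cases hyu : y = u
    · rw [hyu, hinvu]
    · exact hback y hy hyu
  · intro x hx hfx
    rw [g0 x hx, hinvY _ hfx]
  · intro x hfx
    rw [g2 x hfx]; exact (hmem' _).2 hfx

/-- A walk inside `Y` through the matching edge at `v` becomes a path after rematching `Y`. -/
theorem exists_rematch_path [Finite V] {w b v : V} (n : ℕ) : ∀ (f : V → V) (L : List V),
    L.length ≤ n → IsMate G f u → Consistent f u Y → ChainFrom (Step G f u Y) (f w) L b →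
    (∀ y ∈ L, y ∈ Y) → (v ∈ L ∨ f v ∈ L) →
    ∃ (f' : V → V) (P : List V), Rematch G f f' u Y ∧ ChainFrom (Step G f' u Y) (f' w) P b ∧
      P.Nodup ∧ (∀ y ∈ P, y ∈ Y) ∧ (v ∈ P ∨ v ∉ L ∧ f' v ∈ P) := by
  induction n with
  | zero =>
    intro f L hL _ _ hc
    exact absurd (List.length_eq_zero_iff.1 (Nat.le_zero.1 hL)) hc.ne_nil
  | succ n ih =>
    intro f L hLn h hY hL hLY hv
    obtain ⟨τ, hτL, hτ⟩ : ∃ τ ∈ L, v = τ ∨ v ∉ L ∧ f v = τ := by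
      by_cases hvL : v ∈ L
      · exact ⟨v, hvL, .inl rfl⟩
      · exact ⟨f v, hv.resolve_left hvL, .inr ⟨hvL, rfl⟩⟩
    obtain ⟨S, T, rfl⟩ := List.append_of_mem hτL
    obtain ⟨hS, hT⟩ := ChainFrom.split_iff.1 hL
    obtain ⟨P, hP, hPn, hPS, hPl⟩ := hS.exists_nodup
    obtain ⟨Q, hQ, hQn, hQT, hQl⟩ := hT.exists_nodup
    obtain ⟨Q', rfl⟩ : ∃ Q', Q = τ :: Q' := by
      have h1 := hQ.2.1
      cases Q with
      | nil => simp at h1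
      | cons c Q => exact ⟨Q, by simpa using h1⟩
    have hPY : ∀ y ∈ P, y ∈ Y := fun y hy => hLY y (by
      have := hPS hy; simp at this ⊢; tauto)
    have hQY : ∀ y ∈ Q', y ∈ Y := fun y hy => hLY y (by
      have := hQT (List.mem_cons_of_mem _ hy); simp at this ⊢; tauto)
    have hlast : ∀ {a : V} {l : List V}, ChainFrom (Step G f u Y) a l τ → ∃ l', l = l' ++ [τ] :=
      fun hl => ⟨_, (List.dropLast_append_getLast? _ hl.2.2).symm⟩
    by_cases hdis : ∃ y ∈ Q', y ∈ P
    swap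
    · push Not at hdis
      obtain ⟨P', rfl⟩ := hlast hP
      refine ⟨f, P' ++ τ :: Q', .refl h hY, ChainFrom.split_iff.2 ⟨hP, hQ⟩, ?_, ?_, ?_⟩
      · rw [List.append_cons]
        exact List.nodup_append.2 ⟨hPn, (List.nodup_cons.1 hQn).2, fun a ha b hb e =>
          hdis b hb (e ▸ ha)⟩
      · intro y hy
        rw [List.append_cons, List.mem_append] at hy
        exact hy.elim (hPY y) (hQY y)
      · rcases hτ with e | ⟨e1, e⟩
        · left; simp [e]
        · right; simp [e] at e1 ⊢; exact e1
    -- the cycle formed by the two paths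
    obtain ⟨Q₁, y, Q₂, rfl, hyP, hQ₁P⟩ := exists_split_first hdis
    obtain ⟨P₁, P₂, rfl⟩ := List.append_of_mem hyP
    obtain ⟨A, z, Q₃, hAz, hzP, hQ₃P⟩ := exists_split_last (l := y :: Q₂)
      (p := fun x => x ∈ y :: P₂) ⟨y, by simp, by simp⟩
    obtain ⟨B₁, B₂, hB⟩ := List.append_of_mem hzP
    have hQ3 : ∀ x ∈ Q₃, x ∈ y :: Q₂ := fun x hx => by rw [hAz]; simp [hx]
    have hzQ : z ∈ Q₁ ++ y :: Q₂ := List.mem_append_right _ (by rw [hAz]; simp)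
    have hzτ : z ≠ τ := fun e => (List.nodup_cons.1 hQn).1 (e ▸ hzQ)
    obtain ⟨hP1, hP2⟩ := ChainFrom.split_iff.1 hP
    have hQsplit : τ :: (Q₁ ++ y :: Q₂) = (τ :: Q₁) ++ y :: Q₂ := rfl
    obtain ⟨hQ1, hQ2⟩ := ChainFrom.split_iff.1 (hQsplit ▸ hQ)
    have hB2 : ChainFrom (Step G f u Y) z (z :: B₂) τ :=
      (ChainFrom.split_iff.1 (hB ▸ hP2)).2
    obtain ⟨B₀, rfl⟩ : ∃ B₀, B₂ = B₀ ++ [τ] := by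
      obtain ⟨l, hl⟩ := hlast hB2
      cases l with
      | nil => simp at hl; exact absurd hl.1 hzτ
      | cons c l => exact ⟨l, by simpa using (List.cons_eq_cons.1 hl).2⟩
    have hz3 : ChainFrom (Step G f u Y) z (z :: Q₃) b := (ChainFrom.split_iff.1 (hAz ▸ hQ2)).2
    -- `O` is the cycle from `y` along `P` to `τ` and back along `Q₁`. Rotating reverses its arcs:
    -- `P₁` now enters at `k`, the predecessor of `y`, runs back through `K`, hence through `τ`, to
    -- `z`, and continues with `Q₃`.
    set K := z :: B₀ ++ τ :: Q₁ with hK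
    set O := B₁ ++ K with hO
    have hOe : O = y :: P₂ ++ Q₁ := by rw [hB, hO, hK]; simp
    have hcyc : ChainFrom (Step G f u Y) y (O ++ [y]) y := by
      obtain ⟨X, hX⟩ := hlast hP2
      have := ChainFrom.split_iff.2 ⟨hX ▸ hP2, hQ1⟩
      rw [hOe, hX]
      simpa using this
    have hOn : O.Nodup := by
      rw [hOe]
      refine List.nodup_append.2 ⟨(List.nodup_append.1 hPn).2.1,
        (List.nodup_append.1 (List.nodup_cons.1 hQn).2).1, ?_⟩
      rintro a ha c hc rfl
      exact hQ₁P a hc (List.mem_append_right _ ha)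
    have hOY : ∀ c ∈ O, c ∈ Y ∧ c ≠ u := by
      intro c hc
      have e : O ++ [y] = y :: (P₂ ++ Q₁ ++ [y]) := by rw [hOe]; simp
      rw [e] at hcyc
      refine hcyc.mem_of_cons c ?_
      rw [hOe] at hc
      simp at hc ⊢; tauto
    obtain ⟨ρ, hρ0, hρ1, hρ2⟩ := exists_cyclic_perm hOn (by simp [hOe])
    have hρY : ∀ x, x ∉ Y → ρ x = x := fun x hx => hρ0 x fun hxO => hx (hOY x hxO).1
    have hρu : ρ u = u := hρ0 u fun huO => (hOY u huO).2 rfl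
    have hρA : ∀ c ∈ Y, c ≠ u → G.Adj c (f (ρ c)) := by
      intro c _ hcu
      by_cases hcO : c ∈ O
      · obtain ⟨s, t, hst⟩ := List.append_of_mem hcO
        rw [hst] at hcyc
        cases t with
        | nil =>
          rw [hρ2 c y (by rw [hst]; simp) (by rw [hOe]; simp)]
          have := hcyc.1
          rw [List.append_assoc, List.singleton_append, List.isChain_split] at this
          exact (List.isChain_cons_cons.1 this.2).1.arc
        | cons d t =>
          rw [hρ1 s c d t hst]
          have := hcyc.1
          rw [List.append_assoc, List.cons_append, List.isChain_split] at this
          exact (List.isChain_cons_cons.1 this.2).1.arc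
      · rw [hρ0 c hcO]; exact h.adj c hcu
    obtain ⟨g, hg, g1, g2⟩ := exists_rematch_of_perm h hY ρ hρY hρu hρA
    have hKO : ∀ c ∈ K, c ∈ O := fun c hc => List.mem_append_right _ hc
    obtain ⟨k, hk⟩ : ∃ k, K.getLast? = some k := ⟨_, List.getLast?_eq_getLast_of_ne_nil (by simp [hK])⟩
    have hkK : k ∈ K := List.mem_of_mem_getLast? hk
    have hρk : ρ k = y := hρ2 k y
      (by rw [hO, List.getLast?_append_of_ne_nil _ (by simp [hK]), hk]) (by rw [hOe]; simp)
    have hKc : ChainFrom (Step G g u Y) k K.reverse z := by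
      have h1 : O.IsChain fun c d => ρ c = d :=
        List.isChain_iff_forall_rel_of_append_cons_cons.2 fun _ _ _ _ => hρ1 _ _ _ _
      have h2 : ChainFrom (fun c d => ρ c = d) z K k :=
        ⟨h1.right_of_append, by simp [hK], hk⟩
      refine (h2.mono (s := fun c d => Step G g u Y d c) ?_).reverse
      intro c hc d hd e
      refine ⟨(hOY d (hKO d hd)).1, (hOY c (hKO c hc)).1, (hOY c (hKO c hc)).2, ?_⟩
      unfold Arc
      rw [g1 c (hOY c (hKO c hc)).1, e]
      exact h.adj d (hOY d (hKO d hd)).2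
    have hstay : ∀ a c, c ∉ O → Step G f u Y a c → Step G g u Y a c := by
      intro a c hc hac
      refine ⟨hac.1, hac.2.1, hac.2.2.1, ?_⟩
      unfold Arc
      rw [g1 c hac.2.1, hρ0 c hc]
      exact hac.2.2.2
    have hQ₃O : ∀ x ∈ Q₃, x ∉ O := by
      intro x hx hxO
      rw [hOe] at hxO
      rcases List.mem_append.1 hxO with hxO | hxO
      · exact hQ₃P x hx hxO
      · exact (List.nodup_append.1 (List.nodup_cons.1 hQn).2).2.2 x hxO x (hQ3 x hx) rfl
    have hKQ : ChainFrom (Step G g u Y) k (K.reverse ++ Q₃) b := by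
      cases hq : Q₃ with
      | nil =>
        rw [hq] at hz3
        obtain rfl : z = b := by simpa using hz3.2.2
        simpa using hKc
      | cons q Q₃' =>
        rw [hq] at hz3 hQ₃O
        have h1 := List.isChain_cons_cons.1 hz3.1
        refine hKc.append (hstay z q (hQ₃O q (by simp)) h1.1) ?_
        have h2 : ChainFrom (Step G f u Y) q (q :: Q₃') b :=
          ⟨h1.2, by simp, by simpa using hz3.2.2⟩
        exact h2.mono fun a _ c hc => hstay a c (hQ₃O c hc)
    have hP₁O : ∀ x ∈ P₁, x ∉ O := by
      intro x hx hxO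
      rw [hOe] at hxO
      rcases List.mem_append.1 hxO with hxO | hxO
      · exact (List.nodup_append.1 hPn).2.2 x hx x hxO rfl
      · exact hQ₁P x hxO (List.mem_append_left _ hx)
    have hfw : f w ∈ Y := hPY _ hP.start_mem
    -- The start is recorded as the partner of the fixed vertex `w`, because it moves from `y` to
    -- `k` when `P₁` is empty.
    have hnew : ChainFrom (Step G g u Y) (g w) (P₁ ++ (K.reverse ++ Q₃)) b := by
      rw [g2 w hfw]
      rcases P₁.eq_nil_or_concat with rfl | ⟨P₀, d, rfl⟩
      · obtain rfl : y = f w := by simpa using hP.2.1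
        rw [List.nil_append, (Equiv.Perm.inv_eq_iff_eq).2 hρk.symm]
        exact hKQ
      · rw [List.concat_eq_append] at *
        obtain ⟨d', h1, h2, -⟩ := ChainFrom.join_iff.1 ⟨hP, by simp⟩
        have h3 : ρ⁻¹ (f w) = f w := by
          rw [Equiv.Perm.inv_eq_iff_eq, hρ0 _ (hP₁O _ h1.start_mem)]
        rw [h3]
        have h4 : ChainFrom (Step G g u Y) (f w) (P₀ ++ [d]) d' :=
          h1.mono fun a _ c hc => hstay a c (hP₁O c hc)
        refine h4.append ⟨h2.1, (hOY k (hKO k hkK)).1, (hOY k (hKO k hkK)).2, ?_⟩ hKQ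
        unfold Arc
        rw [g1 k (hOY k (hKO k hkK)).1, hρk]
        exact h2.2.2.2
    -- The occurrence of `z` on `Q` is dropped, so the new walk is strictly shorter.
    have hlen : (P₁ ++ (K.reverse ++ Q₃)).length ≤ n := by
      have e1 := congrArg List.length hAz
      have e2 := congrArg List.length hB
      simp [hK] at hLn hPl hQl e1 e2 ⊢
      omega
    have hnewY : ∀ x ∈ P₁ ++ (K.reverse ++ Q₃), x ∈ Y := by
      intro x hx
      simp only [List.mem_append, List.mem_reverse] at hx
      rcases hx with hx | hx | hx
      · exact hPY x (List.mem_append_left _ hx)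
      · exact (hOY x (hKO x hx)).1
      · exact hQY x (List.mem_append_right _ (hQ3 x hx))
    obtain ⟨e, he⟩ : ∃ e, (z :: B₀).getLast? = some e := ⟨_, List.getLast?_eq_getLast_of_ne_nil (by simp)⟩
    obtain ⟨E, hE⟩ : ∃ E, z :: B₀ = E ++ [e] := ⟨_, (List.dropLast_append_getLast? _ he).symm⟩
    have hρe : ρ e = τ := hρ1 (B₁ ++ E) e τ Q₁ (by rw [hO, hK, hE]; simp)
    have heK : e ∈ K := by rw [hK, hE]; simp
    have hτK : τ ∈ K := by simp [hK]
    rcases hτ with hvτ | ⟨hvL, hvτ⟩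
    · subst hvτ
      obtain ⟨f', P, h1, h2, h3, h4, h5⟩ := ih g _ hlen hg.mate hg.consistent hnew hnewY
        (.inl (by simp [hτK]))
      refine ⟨f', P, hg.trans h h1, h2, h3, h4, .inl (h5.resolve_right fun h6 => h6.1 ?_)⟩
      simp [hτK]
    -- Here only the partner of `v` is on the walk. The new partner of `v` is the predecessor of `τ`
    -- on `O`, which lies in `K` because `z ≠ τ`.
    · have hgv : g v = e := by
        rw [g2 v (by rw [hvτ]; exact (hOY τ (hKO τ hτK)).1), hvτ, Equiv.Perm.inv_eq_iff_eq, hρe]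
      obtain ⟨f', P, h1, h2, h3, h4, h5⟩ := ih g _ hlen hg.mate hg.consistent hnew hnewY
        (.inr (by simp [hgv, heK]))
      exact ⟨f', P, hg.trans h h1, h2, h3, h4, h5.imp_right fun h6 => ⟨hvL, h6.2⟩⟩

end SterboulDeming

/-! ### Growing consistent sets; the flower case. -/

namespace SterboulDeming

variable {V : Type*} {G : SimpleGraph V} {f f' : V → V} {u v : V} {Y : Set V}

open Relation (ReflTransGen)

theorem exists_exit {α : Type*} {r : α → α → Prop} {a c : α} {S : Set α}
    (h : ReflTransGen r a c) (ha : a ∈ S) (hc : c ∉ S) : ∃ x ∈ S, ∃ z ∉ S, r x z := by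
  induction h with
  | refl => exact absurd ha hc
  | @tail b c _ hbc ih =>
    by_cases hb : b ∈ S
    · exact ⟨b, hb, c, hc, hbc⟩
    · exact ih hb

theorem IsMate.reach_conj (h : IsMate G f u) {x z : V} (hxz : ReflTransGen (Arc G f) x z) :
    ReflTransGen (Arc G f) (f z) (f x) := by
  induction hxz with
  | refl => exact .refl
  | tail _ hbc ih => exact .head (h.arc_conj hbc) ih

theorem Step.reach_mono {Z : Set V} (hYZ : Y ⊆ Z) {x z : V}
    (h : ReflTransGen (Step G f u Y) x z) : ReflTransGen (Step G f u Z) x z :=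
  ReflTransGen.mono (fun _ _ => Step.mono hYZ) _ _ h

theorem Step.mem_of_reach {x z : V} (h : ReflTransGen (Step G f u Y) x z) (hx : x ∈ Y) :
    z ∈ Y := by
  induction h with
  | refl => exact hx
  | tail _ hbc _ => exact hbc.2.1

theorem Step.reach_restrict {W : Set V} {a c : V} (h : ReflTransGen (Step G f u Y) a c)
    (hW : ∀ x, ReflTransGen (Step G f u Y) a x → ReflTransGen (Step G f u Y) x c → x ∈ W) :
    ReflTransGen (Step G f u W) a c := by
  induction h with
  | refl => exact .refl
  | @tail b c hab hbc ih =>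
    refine (ih fun x h1 h2 => hW x h1 (h2.tail hbc)).tail ⟨hW b hab (.single hbc), ?_, hbc.2.2⟩
    exact hW c (hab.tail hbc) .refl

theorem exists_chain_through {a b c : V} (hac : ReflTransGen (Step G f u Y) a c)
    (hcb : ReflTransGen (Step G f u Y) c b) (ha : a ∈ Y) :
    ∃ L, ChainFrom (Step G f u Y) a L b ∧ c ∈ L ∧ ∀ y ∈ L, y ∈ Y := by
  obtain ⟨l, hl, -⟩ := exists_chainFrom_of_reach hac
  obtain ⟨m, hm, -⟩ := exists_chainFrom_of_reach hcb
  obtain ⟨l', rfl⟩ : ∃ l', l = l' ++ [c] :=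
    ⟨_, (List.dropLast_append_getLast? _ hl.2.2).symm⟩
  obtain ⟨m', rfl⟩ : ∃ m', m = c :: m' := by
    have h1 := hm.2.1
    cases m with
    | nil => simp at h1
    | cons d m => exact ⟨m, by simpa using h1⟩
  have hc := ChainFrom.split_iff.2 ⟨hl, hm⟩
  refine ⟨_, hc, by simp, fun y hy => ?_⟩
  obtain ⟨s, t, hst⟩ := List.append_of_mem hy
  rw [hst] at hc
  exact Step.mem_of_reach (ChainFrom.split_iff.1 hc).1.reach ha

theorem Consistent.insert (h : IsMate G f u) (hY : Consistent f u Y) {z : V} (hz : f z ∉ Y) :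
    Consistent f u (insert z Y) := by
  rintro y (rfl | hy) hfy
  · by_contra hyu
    exact hfy.elim (h.apply_ne hyu) hz
  · rcases hfy with e | hfy
    · exact absurd (by rwa [← h.eq_comm.1 e]) hz
    · exact hY y hy hfy

/-- The part of a consistent set reachable from one of its members can be left along an arc. -/
theorem exists_edge_or_new (h : IsMate G f u) (H : ∀ x, ReflTransGen (Arc G f) u x)
    (hV : ∃ z, z ≠ u) (hY : Consistent f u Y) {a : V} (ha : a ∈ Y) :
    ∃ b z, ReflTransGen (Step G f u Y) a b ∧ Arc G f b z ∧ (f z ∈ Y ∨ z ∉ Y ∧ f z ∉ Y) := by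
  have hsub : ∀ x, ReflTransGen (Step G f u Y) a x → x ∈ Y := fun x hx => Step.mem_of_reach hx ha
  obtain ⟨w, hw⟩ : ∃ w, ¬ ReflTransGen (Step G f u Y) a w := by
    by_contra! hall
    obtain ⟨z, hz⟩ := hV
    exact hz (hY z (hsub _ (hall z)) (hsub _ (hall (f z))))
  -- Conjugate of a walk from `u` to `f a`; hence every vertex is reachable from `a`.
  have hau : ReflTransGen (Arc G f) a u := by
    have := h.reach_conj (H (f a))
    rwa [h.inv, h.fix] at this
  obtain ⟨b, hb, z, hz, hbz⟩ := exists_exit (S := {x | ReflTransGen (Step G f u Y) a x})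
    (hau.trans (H w)) ReflTransGen.refl hw
  refine ⟨b, z, hb, hbz, ?_⟩
  by_cases hfz : f z ∈ Y
  · exact .inl hfz
  · refine .inr ⟨fun hzY => hz (ReflTransGen.tail hb ⟨hsub b hb, hzY, ?_, hbz⟩), hfz⟩
    rintro rfl
    exact hfz (by rwa [h.fix])

/-- In a maximal set grown from `u`, the arc leaving the part reachable from `v` or `f v` cannot add
a vertex, so it gives an edge between two members. The walk to one of its ends is routed through the
matching edge of `v`. -/
theorem exists_memFlower [Finite V] (h : IsMate G f u) (H : ∀ x, ReflTransGen (Arc G f) u x)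
    (hV : ∃ z, z ≠ u) (hY : Consistent f u Y) (hu : u ∈ Y)
    (hr : ∀ y ∈ Y, ReflTransGen (Step G f u Y) u y) (hv : v ∈ Y ∨ f v ∈ Y) :
    ∃ f', ∃ h' : IsMate G f' u, MemFlower h'.matching v := by
  let 𝒴 : Set (Set V) := {Y | Consistent f u Y ∧ u ∈ Y ∧
    (∀ y ∈ Y, ReflTransGen (Step G f u Y) u y) ∧ (v ∈ Y ∨ f v ∈ Y)}
  obtain ⟨Z, -, hZ⟩ := (Set.toFinite 𝒴).exists_le_maximal (a := Y) ⟨hY, hu, hr, hv⟩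
  obtain ⟨hZc, huZ, hZr, hvZ⟩ := hZ.prop
  obtain ⟨a, haZ, ha⟩ : ∃ a ∈ Z, a = v ∨ a = f v := by
    rcases hvZ with h1 | h1
    exacts [⟨_, h1, .inl rfl⟩, ⟨_, h1, .inr rfl⟩]
  obtain ⟨b, z, hab, hbz, hz⟩ := exists_edge_or_new h H hV hZc haZ
  have hbZ := Step.mem_of_reach hab haZ
  rcases hz with hz | ⟨hz, hfz⟩
  · obtain ⟨L, hL, haL, hLZ⟩ := exists_chain_through (hZr a haZ) hab huZ
    have hL' : ChainFrom (Step G f u Z) (f u) L b := by rwa [h.fix]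
    obtain ⟨f', P, h1, h2, h3, -, h5⟩ := exists_rematch_path L.length f L le_rfl h hZc hL' hLZ
      (v := v) (by rcases ha with rfl | rfl; exacts [.inl haL, .inr haL])
    rw [h1.mate.fix] at h2
    exact ⟨f', h1.mate, memFlower_of_chain h1.mate h1.consistent huZ h2 h3
      (h1.reach _ _ (hZr _ hz)) hbz (h5.imp_right And.right)⟩
  · refine absurd (hZ.le_of_ge (y := insert z Z) ⟨hZc.insert h hfz, .inr huZ, ?_, ?_⟩
      (Set.subset_insert z Z) (Set.mem_insert z Z)) hz
    · rintro y (rfl | hy)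
      · refine (Step.reach_mono (Set.subset_insert _ _) (hZr b hbZ)).tail
          ⟨.inr hbZ, .inl rfl, ?_, hbz⟩
        rintro rfl
        exact hz huZ
      · exact Step.reach_mono (Set.subset_insert _ _) (hZr y hy)
    · exact hvZ.imp .inr .inr

/-- A consistent set containing a neighbour of `u` and a walk to it from `a` turns into a
consistent set grown from `u` by conjugation. -/
theorem exists_rooted_of_adj (h : IsMate G f u) (hY : Consistent f u Y) (hu : u ∉ Y) {a z : V}
    (ha : a ∈ Y) (haz : ReflTransGen (Step G f u Y) a z) (hzu : G.Adj z u) :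
    ∃ Z, Consistent f u Z ∧ u ∈ Z ∧ (∀ y ∈ Z, ReflTransGen (Step G f u Z) u y) ∧ f a ∈ Z := by
  set Z : Set V := insert u {x | f x ∈ Y ∧ ReflTransGen (Step G f u Y) (f x) z} with hZdef
  have hzY := Step.mem_of_reach haz ha
  have hne : ∀ y ∈ Y, y ≠ u := fun y hy e => hu (e ▸ hy)
  have hmem : ∀ y ∈ Y, ReflTransGen (Step G f u Y) y z → f y ∈ Z := fun y hy hyz =>
    .inr ⟨by rwa [h.inv], by rwa [h.inv]⟩
  have hreach : ∀ y, ReflTransGen (Step G f u Y) y z → y ∈ Y →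
      ReflTransGen (Step G f u Z) u (f y) := by
    intro y hyz
    induction hyz using ReflTransGen.head_induction_on with
    | refl =>
      intro hy
      refine .single ⟨.inl rfl, hmem z hy .refl, h.apply_ne_root (hne z hy), ?_⟩
      unfold Arc
      rw [h.inv]; exact hzu.symm
    | @head x c hxc hcz ih =>
      intro hx
      exact (ih hxc.2.1).tail ⟨hmem c hxc.2.1 hcz, hmem x hx (.head hxc hcz),
        h.apply_ne_root (hne x hx), h.arc_conj hxc.arc⟩
  refine ⟨Z, ?_, .inl rfl, ?_, hmem a ha haz⟩
  · rintro y (rfl | ⟨h1, -⟩) h2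
    · rfl
    · rcases h2 with h2 | ⟨h2, -⟩
      · exact absurd (h2 ▸ h1) hu
      · exact absurd (hY _ h1 h2) (hne _ h1)
  · rintro y (rfl | ⟨h1, h2⟩)
    · exact .refl
    · have := hreach _ h2 h1
      rwa [h.inv] at this

end SterboulDeming

/-! ### Configurations; the Tposy case. -/

namespace SterboulDeming

variable {V : Type*} {G : SimpleGraph V} {f f' : V → V} {u v : V} {Y : Set V}

open Relation (ReflTransGen)

theorem ChainFrom.mono_of_cons {α : Type*} {r s : α → α → Prop} {a a' b : α} {l : List α}
    (h : ChainFrom r a (a' :: l) b) (hrs : ∀ x, ∀ y ∈ l, r x y → s x y) :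
    ChainFrom s a (a' :: l) b := by
  refine ⟨?_, h.2⟩
  obtain ⟨h, -⟩ := h
  induction l generalizing a' with
  | nil => simp
  | cons c l ih =>
    have h1 := List.isChain_cons_cons.1 h
    exact List.isChain_cons_cons.2 ⟨hrs _ _ (by simp) h1.1,
      ih (fun x y hy => hrs x y (by simp [hy])) h1.2⟩

theorem DistinctNodes.apply_notMem (h : IsMate G f u) {L : List V} (hd : DistinctNodes f L)
    (hu : ∀ x ∈ L, x ≠ u) {x : V} (hx : x ∈ L) : f x ∉ L := by
  intro hfx
  have h1 : L.Pairwise fun x y => x = f y → x = y := hd.imp fun h1 h2 => absurd h2 h1.2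
  have : Std.Symm fun x y => x = f y → x = y :=
    ⟨fun x y hxy e => (hxy (h.eq_comm.1 e.symm)).symm⟩
  have h2 := h1.forall_of_forall (fun _ _ _ => rfl) hfx hx rfl
  exact h.apply_ne (hu x hx) h2

/-- A consistent set `Y` all of whose members lead to `v`, together with a chain `R` outside of `Y`
closing up `f y₁` to `y₂`. -/
structure Config (G : SimpleGraph V) (f : V → V) (u v : V) (Y : Set V) (y₁ y₂ : V)
    (R : List V) : Prop where
  consistent : Consistent f u Y
  root : u ∉ Y
  mem : v ∈ Y
  mem₁ : y₁ ∈ Y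
  mem₂ : y₂ ∈ Y
  reach : ∀ y ∈ Y, ReflTransGen (Step G f u Y) y v
  from_end : (y₁ = y₂ ∧ ∀ y ∈ Y, ReflTransGen (Step G f u Y) y₁ y) ∨
    ∀ y ∈ Y, ReflTransGen (Step G f u Y) v y
  chain : ChainFrom (Arc G f) (f y₁) (f y₁ :: R ++ [y₂]) y₂
  distinct : DistinctNodes f R
  off : ∀ r ∈ R, r ≠ u ∧ r ∉ Y ∧ f r ∉ Y

/-- A consistent set around a configuration, its new members being reachable from `v`. -/
structure Around (G : SimpleGraph V) (f : V → V) (u v : V) (Y : Set V) (R : List V)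
    (Z : Set V) : Prop where
  consistent : Consistent f u Z
  root : u ∉ Z
  subset : Y ⊆ Z
  reach : ∀ z ∈ Z, z ∈ Y ∨ ReflTransGen (Step G f u Z) v z
  off : ∀ r ∈ R, r ∉ Z ∧ f r ∉ Z

variable {y₁ y₂ : V} {R : List V} {Z : Set V}

/-- Conjugating the outer chain exchanges its ends, so meeting the partner of a vertex of `R`
reduces to meeting `R`. -/
theorem Config.swap (h : IsMate G f u) (c : Config G f u v Y y₁ y₂ R) :
    Config G f u v Y y₂ y₁ (R.map f).reverse where
  consistent := c.consistent
  root := c.root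
  mem := c.mem
  mem₁ := c.mem₂
  mem₂ := c.mem₁
  reach := c.reach
  from_end := c.from_end.imp_left fun ⟨h1, h2⟩ => ⟨h1.symm, h1 ▸ h2⟩
  chain := by
    have := c.chain.reverse_map h
    rw [h.inv] at this
    simpa [h.inv] using this
  distinct := c.distinct.reverse_map h
  off r hr := by
    simp only [List.mem_reverse, List.mem_map] at hr
    obtain ⟨s, hs, rfl⟩ := hr
    have := c.off s hs
    exact ⟨h.apply_ne_root this.1, this.2.2, by rw [h.inv]; exact this.2.1⟩

theorem Around.swap (h : IsMate G f u) (a : Around G f u v Y R Z) :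
    Around G f u v Y (R.map f).reverse Z where
  consistent := a.consistent
  root := a.root
  subset := a.subset
  reach := a.reach
  off r hr := by
    simp only [List.mem_reverse, List.mem_map] at hr
    obtain ⟨s, hs, rfl⟩ := hr
    exact ⟨(a.off s hs).2, by rw [h.inv]; exact (a.off s hs).1⟩

/-- A walk from `y₁` through `v` to `b₁` is made simple by rematching `Z`. The outer chain is
disjoint from `Z` and its partners, so it survives apart from its last arc. -/
theorem Config.exists_memTposy [Finite V] (h : IsMate G f u) (c : Config G f u v Y y₁ y₂ R)
    (a : Around G f u v Y R Z) {b₁ b₂ : V} (hb₁ : ReflTransGen (Step G f u Z) v b₁)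
    (hb₂ : b₂ ∈ Z) (hb : G.Adj b₁ b₂) :
    ∃ f', ∃ h' : IsMate G f' u, MemTposy h'.matching v := by
  have hmono : ∀ {x y}, ReflTransGen (Step G f u Y) x y → ReflTransGen (Step G f u Z) x y :=
    Step.reach_mono a.subset
  obtain ⟨L, hL, hvL, hLZ⟩ := exists_chain_through (hmono (c.reach _ c.mem₁)) hb₁
    (a.subset c.mem₁)
  have hL' : ChainFrom (Step G f u Z) (f (f y₁)) L b₁ := by rwa [h.inv]
  obtain ⟨f', P, h1, h2, h3, h4, h5⟩ := exists_rematch_path L.length f L le_rfl h a.consistent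
    hL' hLZ (v := v) (.inl hvL)
  have hvP : v ∈ P := h5.resolve_right fun h6 => h6.1 hvL
  have hoff : ∀ r ∈ R, f' r = f r := fun r hr => h1.off r (a.off r hr).1 (a.off r hr).2
  -- `f y₁` and `f y₂` stay put while their partners change; the new partners still lead to `y₁` and
  -- `y₂`.
  have hy₁ := h1.swap _ (a.subset c.mem₁)
  have hy₂ := h1.swap _ (a.subset c.mem₂)
  obtain ⟨d, hc1, hc2, -⟩ := ChainFrom.join_iff.1 ⟨c.chain, by simp⟩
  have hR : ChainFrom (Arc G f') (f y₁) (f y₁ :: R ++ [f' (f y₂)]) (f' (f y₂)) := by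
    refine (hc1.mono_of_cons (s := Arc G f') fun x y hy hxy => ?_).append ?_ (.refl _ _)
    · unfold Arc at *
      rwa [hoff y hy]
    · unfold Arc at *
      rwa [h1.mate.inv]
  have hR' : ChainFrom (Arc G f') (f' (f' (f y₁))) (f' (f' (f y₁)) :: R ++ [f' (f y₂)])
      (f' (f y₂)) := by rwa [h1.mate.inv]
  have hRd : DistinctNodes f' R := c.distinct.imp_of_mem fun {x y} hx hy hxy => by
    rwa [hoff y hy]
  have hRY : ∀ r ∈ R, r ≠ u ∧ r ∉ Z ∧ f' r ∉ Z := fun r hr => by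
    rw [hoff r hr]
    exact ⟨(c.off r hr).1, a.off r hr⟩
  -- The two blossoms must be linked through a vertex of `P` that `y₂` reaches and that leads to
  -- `b₂`: either `v`, or the start of `P` when `y₁ = y₂`.
  have key : ReflTransGen (Step G f u Z) v b₂ ∨
      y₁ = y₂ ∧ ReflTransGen (Step G f u Z) y₁ b₂ := by
    rcases a.reach b₂ hb₂ with h6 | h6
    · rcases c.from_end with ⟨h7, h8⟩ | h7
      · exact .inr ⟨h7, hmono (h8 _ h6)⟩
      · exact .inl (hmono (h7 _ h6))
    · exact .inl h6
  refine ⟨f', h1.mate, ?_⟩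
  rcases key with h6 | ⟨rfl, h6⟩
  · exact memTposy_of_chain h1.mate h1.consistent a.root h2 h3 h4 hR' hRd hRY hvP
      (hy₂.trans (h1.reach _ _ (hmono (c.reach _ c.mem₂)))) (h1.reach _ _ h6) hb hvP
  · exact memTposy_of_chain h1.mate h1.consistent a.root h2 h3 h4 hR' hRd hRY h2.start_mem
      .refl (hy₁.trans (h1.reach _ _ h6)) hb hvP

/-- The walks from `v` to `b` and the tail of `R` from `z` are absorbed into `Y`. This tail leads to
`y₂` and so back to `v`; the rest `R₁` of the chain now ends at `z`. -/
theorem Config.exists_larger (h : IsMate G f u) (c : Config G f u v Y y₁ y₂ R)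
    (a : Around G f u v Y R Z) {b z : V} (hb : ReflTransGen (Step G f u Z) v b)
    (hbz : Arc G f b z) (hz : z ∈ R) :
    ∃ Y' y₁' y₂' R', Y ⊆ Y' ∧ z ∈ Y' ∧ Config G f u v Y' y₁' y₂' R' := by
  obtain ⟨R₁, R₂, rfl⟩ := List.append_of_mem hz
  set X : Set V := {x | ReflTransGen (Step G f u Z) v x ∧ ReflTransGen (Step G f u Z) x b} with hX
  set T : Set V := {x | x ∈ z :: R₂} with hT
  set Y' : Set V := Y ∪ X ∪ T with hY'
  have hYY' : Y ⊆ Y' := fun x hx => .inl (.inl hx)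
  have hXY' : X ⊆ Y' := fun x hx => .inl (.inr hx)
  have hTY' : T ⊆ Y' := fun x hx => .inr hx
  have hXZ : X ⊆ Z := fun x hx => Step.mem_of_reach hx.1 (a.subset c.mem)
  have hYXZ : ∀ x ∈ Y ∪ X, x ∈ Z := fun x hx => hx.elim (a.subset ·) (hXZ ·)
  have hTR : ∀ x ∈ T, x ∈ R₁ ++ z :: R₂ := fun x hx => List.mem_append_right _ hx
  have hbX : b ∈ X := ⟨hb, .refl⟩
  have hzT : z ∈ T := List.mem_cons_self
  have hRne : ∀ x ∈ R₁ ++ z :: R₂, x ≠ u := fun x hx => (c.off x hx).1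
  have hmono : ∀ {x y}, ReflTransGen (Step G f u Y) x y → ReflTransGen (Step G f u Y') x y :=
    Step.reach_mono hYY'
  have hbz' : Step G f u Y' b z := ⟨hXY' hbX, hTY' hzT, hRne z hz, hbz⟩
  have hchain : ChainFrom (Arc G f) (f y₁) ((f y₁ :: R₁) ++ z :: (R₂ ++ [y₂])) y₂ := by
    simpa using c.chain
  obtain ⟨hc1, hc2⟩ := ChainFrom.split_iff.1 hchain
  have hstep : ChainFrom (Step G f u Y') z (z :: R₂ ++ [y₂]) y₂ := by
    refine hc2.mono fun x hx y hy hxy => ?_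
    have hm : ∀ w ∈ z :: R₂ ++ [y₂], w ∈ Y' ∧ w ≠ u := by
      intro w hw
      rcases List.mem_append.1 hw with hw | hw
      · exact ⟨hTY' hw, hRne w (hTR w hw)⟩
      · rw [List.mem_singleton.1 hw]
        exact ⟨hYY' c.mem₂, fun e => c.root (e ▸ c.mem₂)⟩
    exact ⟨(hm x hx).1, (hm y hy).1, (hm y hy).2, hxy⟩
  have hTreach : ∀ x ∈ T, ReflTransGen (Step G f u Y') z x ∧
      ReflTransGen (Step G f u Y') x y₂ := by
    intro x hx
    obtain ⟨s, t, hst⟩ := List.append_of_mem hx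
    rw [hst, List.append_assoc, List.cons_append] at hstep
    have := ChainFrom.split_iff.1 hstep
    exact ⟨this.1.reach, this.2.reach⟩
  have hvX : ∀ x ∈ X, ReflTransGen (Step G f u Y') v x := fun x hx =>
    Step.reach_restrict hx.1 fun w h1 h2 => hXY' ⟨h1, h2.trans hx.2⟩
  have hXb : ∀ x ∈ X, ReflTransGen (Step G f u Y') x b := fun x hx =>
    Step.reach_restrict hx.2 fun w h1 h2 => hXY' ⟨hx.1.trans h1, h2⟩
  have hvz : ReflTransGen (Step G f u Y') v z := (hvX b hbX).tail hbz'
  refine ⟨Y', y₁, z, R₁, hYY', hTY' hzT, ?_⟩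
  refine ⟨?_, ?_, hYY' c.mem, hYY' c.mem₁, hTY' hzT, ?_, .inr ?_, hc1,
    (List.pairwise_append.1 c.distinct).1, ?_⟩
  · rintro x (hx | hx) (hfx | hfx)
    · exact a.consistent x (hYXZ x hx) (hYXZ _ hfx)
    · exact absurd (by rw [h.inv]; exact hYXZ x hx) (a.off _ (hTR _ hfx)).2
    · exact absurd (hYXZ _ hfx) (a.off _ (hTR _ hx)).2
    · exact absurd (hTR _ hfx) (c.distinct.apply_notMem h hRne (hTR x hx))
  · rintro (hx | hx)
    · exact a.root (hYXZ u hx)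
    · exact hRne u (hTR u hx) rfl
  · have hy₂v := hmono (c.reach _ c.mem₂)
    rintro x ((hx | hx) | hx)
    · exact hmono (c.reach x hx)
    · exact ((hXb x hx).tail hbz').trans ((hTreach z hzT).2.trans hy₂v)
    · exact (hTreach x hx).2.trans hy₂v
  · rintro x ((hx | hx) | hx)
    · rcases c.from_end with ⟨rfl, h7⟩ | h7
      · exact hvz.trans ((hTreach z hzT).2.trans (hmono (h7 x hx)))
      · exact hmono (h7 x hx)
    · exact hvX x hx
    · exact hvz.trans (hTreach x hx).1
  · intro r hr
    have hrR : r ∈ R₁ ++ z :: R₂ := List.mem_append_left _ hr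
    have hd := (List.pairwise_append.1 c.distinct).2.2 r hr
    refine ⟨hRne r hrR, ?_, ?_⟩
    · rintro (hx | hx)
      · exact (a.off r hrR).1 (hYXZ _ hx)
      · exact (hd r hx).1 rfl
    · rintro (hx | hx)
      · exact (a.off r hrR).2 (hYXZ _ hx)
      · exact (hd _ hx).2 (h.inv r).symm

/-- In a maximal set around `Y`, the exit arc gives a closing edge, meets `R` or its partners, or
ends at `u`; the last would yield a rooted set containing `f v`. -/
theorem Config.exists_memTposy_or_larger [Finite V] (h : IsMate G f u)
    (H : ∀ x, ReflTransGen (Arc G f) u x) (hV : ∃ z, z ≠ u)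
    (hF : ∀ Z, Consistent f u Z → u ∈ Z → (∀ y ∈ Z, ReflTransGen (Step G f u Z) u y) → f v ∉ Z)
    (c : Config G f u v Y y₁ y₂ R) :
    (∃ f', ∃ h' : IsMate G f' u, MemTposy h'.matching v) ∨
      ∃ Y' y₁' y₂' R', Y ⊂ Y' ∧ Config G f u v Y' y₁' y₂' R' := by
  obtain ⟨Z, -, hZ⟩ := (Set.toFinite {Z | Around G f u v Y R Z}).exists_le_maximal (a := Y)
    ⟨c.consistent, c.root, subset_rfl, fun _ => .inl, fun r hr => (c.off r hr).2⟩
  have a : Around G f u v Y R Z := hZ.prop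
  have hvZ := a.subset c.mem
  obtain ⟨b, z, hvb, hbz, hz⟩ := exists_edge_or_new h H hV a.consistent hvZ
  have hbZ := Step.mem_of_reach hvb hvZ
  rcases hz with hz | ⟨hz, hfz⟩
  · exact .inl (c.exists_memTposy h a hvb hz hbz)
  right
  by_cases hzR : z ∈ R
  · obtain ⟨Y', y₁', y₂', R', h1, h2, h3⟩ := c.exists_larger h a hvb hbz hzR
    exact ⟨Y', y₁', y₂', R', ⟨h1, fun h4 => (c.off z hzR).2.1 (h4 h2)⟩, h3⟩
  by_cases hfzR : f z ∈ R
  · obtain ⟨Y', y₁', y₂', R', h1, h2, h3⟩ := (c.swap h).exists_larger h (a.swap h) hvb hbz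
      (by simp only [List.mem_reverse, List.mem_map]; exact ⟨_, hfzR, h.inv z⟩)
    exact ⟨Y', y₁', y₂', R', ⟨h1, fun h4 => hz (a.subset (h4 h2))⟩, h3⟩
  have hzu : z ≠ u := by
    rintro rfl
    obtain ⟨W, h1, h2, h3, h4⟩ := exists_rooted_of_adj h a.consistent a.root hvZ hvb
      (by have := hbz; unfold Arc at this; rwa [h.fix] at this)
    exact hF W h1 h2 h3 h4
  refine absurd (hZ.le_of_ge (y := insert z Z) ?_ (Set.subset_insert z Z)
    (Set.mem_insert z Z)) hz
  have hmono : ∀ {x y}, ReflTransGen (Step G f u Z) x y →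
      ReflTransGen (Step G f u (insert z Z)) x y := Step.reach_mono (Set.subset_insert _ _)
  refine ⟨a.consistent.insert h hfz, ?_, a.subset.trans (Set.subset_insert _ _), ?_, ?_⟩
  · rintro (e | e)
    exacts [hzu e.symm, a.root e]
  · rintro y (rfl | hy)
    · exact .inr ((hmono hvb).tail ⟨.inr hbZ, .inl rfl, hzu, hbz⟩)
    · exact (a.reach y hy).imp_right hmono
  · refine fun r hr => ⟨?_, ?_⟩
    · rintro (e | e)
      exacts [hzR (e ▸ hr), (a.off r hr).1 e]
    · rintro (e | e)
      · exact hfzR (by rwa [← e, h.inv])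
      · exact (a.off r hr).2 e

/-- A maximal set grown from `f v` has a closing edge, hence a blossom at some `p`. The conjugate of
the walk from `f v` to `p` is `Y`, running from `f p` to `v`; the rest of the blossom is the outer
chain from `p` to `f p`. -/
theorem exists_config [Finite V] (h : IsMate G f u)
    (H : ∀ x, ReflTransGen (Arc G f) u x) (hV : ∃ z, z ≠ u) (hvu : v ≠ u)
    (hF : ∀ Z, Consistent f u Z → u ∈ Z → (∀ y ∈ Z, ReflTransGen (Step G f u Z) u y) → v ∉ Z) :
    ∃ Y y₁ y₂ R, Config G f u v Y y₁ y₂ R := by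
  have hfvu := h.apply_ne_root hvu
  let 𝒵 : Set (Set V) := {Z | Consistent f u Z ∧ u ∉ Z ∧ f v ∈ Z ∧
    ∀ z ∈ Z, ReflTransGen (Step G f u Z) (f v) z}
  obtain ⟨Z, -, hZ⟩ := (Set.toFinite 𝒵).exists_le_maximal (a := {f v}) (by
    refine ⟨?_, fun e => hfvu e.symm, rfl, ?_⟩
    · rintro y rfl h1
      exact absurd (h.inj h1) (h.apply_ne hvu)
    · rintro y rfl
      exact .refl)
  obtain ⟨hZc, huZ, hvZ, hZr⟩ := hZ.prop
  have hne : ∀ y ∈ Z, y ≠ u := fun y hy e => huZ (e ▸ hy)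
  have hZf : ∀ y ∈ Z, f y ∉ Z := fun y hy hfy => hne y hy (hZc y hy hfy)
  obtain ⟨b, z, hvb, hbz, hz⟩ := exists_edge_or_new h H hV hZc hvZ
  have hbZ := Step.mem_of_reach hvb hvZ
  rcases hz with hz | ⟨hz, hfz⟩
  swap
  · exfalso
    have hzu : z ≠ u := by
      rintro rfl
      obtain ⟨W, h1, h2, h3, h4⟩ := exists_rooted_of_adj h hZc huZ hvZ hvb
        (by have := hbz; unfold Arc at this; rwa [h.fix] at this)
      rw [h.inv] at h4
      exact hF W h1 h2 h3 h4
    refine hz (hZ.le_of_ge (y := insert z Z) ⟨hZc.insert h hfz, ?_, .inr hvZ, ?_⟩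
      (Set.subset_insert z Z) (Set.mem_insert z Z))
    · rintro (e | e)
      exacts [hzu e.symm, huZ e]
    · rintro y (rfl | hy)
      · exact (Step.reach_mono (Set.subset_insert _ _) hvb).tail ⟨.inr hbZ, .inl rfl, hzu, hbz⟩
      · exact Step.reach_mono (Set.subset_insert _ _) (hZr y hy)
  obtain ⟨P, hP, hPn⟩ := exists_chainFrom_of_reach hvb
  have hPZ : ∀ y ∈ P, y ∈ Z := fun y hy => by
    obtain ⟨s, t, rfl⟩ := List.append_of_mem hy
    exact Step.mem_of_reach (ChainFrom.split_iff.1 hP).1.reach hvZ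
  obtain ⟨p, hpP, η, hη, hηn, hηP, -⟩ := exists_last_exit (S := {y | y ∈ P}) (hZr _ hz)
    hP.start_mem
  obtain ⟨A, B, rfl⟩ := List.append_of_mem hpP
  obtain ⟨hA, hB⟩ := ChainFrom.split_iff.1 hP
  have hηZ := hη.mem_of_cons
  have hPn' : ((A ++ [p]) ++ B).Nodup := by simpa using hPn
  have hAB : ∀ x ∈ B, x ∉ A ++ [p] := fun x hx hx' =>
    (List.nodup_append.1 hPn').2.2 x hx' x hx rfl
  have hAP : ∀ x ∈ A ++ [p], x ∈ A ++ p :: B := fun x hx => by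
    simp only [List.mem_append, List.mem_cons] at hx ⊢; tauto
  have hBP : ∀ x ∈ B, x ∈ A ++ p :: B := fun x hx => by
    simp only [List.mem_append, List.mem_cons]; tauto
  have hBη : ∀ x ∈ B ++ η, x ∈ Z ∧ x ∉ A ++ [p] := by
    intro x hx
    rcases List.mem_append.1 hx with hx | hx
    · exact ⟨hPZ x (hBP x hx), hAB x hx⟩
    · exact ⟨(hηZ x hx).1, fun hx' => hηP x hx (hAP x hx')⟩
  set Y : Set V := {x | f x ∈ A ++ [p]} with hY
  have hmemY : ∀ x ∈ A ++ [p], f x ∈ Y := fun x hx => by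
    rw [hY, Set.mem_ofPred_eq, h.inv]; exact hx
  have hYZ : ∀ y ∈ Y, f y ∈ Z := fun y hy => hPZ _ (hAP _ hy)
  have hc : ChainFrom (Step G f u Y) (f p) ((A ++ [p]).map f).reverse v := by
    have := (hA.map (t := fun x y => Step G f u Y y x) f fun x hx y hy hxy =>
      ⟨hmemY y hy, hmemY x hx, h.apply_ne_root (hne x (hPZ x (hAP x hx))), h.arc_conj hxy.arc⟩).reverse
    rwa [h.inv] at this
  have hYr : ∀ y ∈ Y, ReflTransGen (Step G f u Y) (f p) y ∧ ReflTransGen (Step G f u Y) y v := by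
    intro y hy
    obtain ⟨s, t, hst⟩ := List.append_of_mem (show y ∈ ((A ++ [p]).map f).reverse by
      rw [List.mem_reverse, List.mem_map]; exact ⟨f y, hy, h.inv y⟩)
    rw [hst] at hc
    exact ⟨(ChainFrom.split_iff.1 hc).1.reach, (ChainFrom.split_iff.1 hc).2.reach⟩
  have hd : DistinctNodes f (B ++ η) := by
    refine DistinctNodes.of_consistent h hZc (List.nodup_append.2
      ⟨(List.nodup_append.1 hPn').2.1, (List.nodup_cons.1 hηn).2, ?_⟩) fun x hx => (hBη x hx).1
    rintro x hx y hy rfl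
    exact hηP x hy (hBP x hx)
  refine ⟨Y, f p, f p, B ++ (η.map f).reverse, ?_, ?_, ?_, hmemY p (by simp),
    hmemY p (by simp), fun y hy => (hYr y hy).2, .inl ⟨rfl, fun y hy => (hYr y hy).1⟩, ?_,
    hd.append_reverse_map h, ?_⟩
  · intro y hy hfy
    exact absurd (hYZ _ hfy) (hZf _ (hYZ y hy))
  · intro hu
    have := hYZ u hu
    rw [h.fix] at this
    exact huZ this
  · have := hmemY _ hA.start_mem
    rwa [h.inv] at this
  · rw [h.inv]
    have := hB.arc.append (show Arc G f b (f (f z)) by rwa [h.inv]) (hη.arc.reverse_map h)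
    simpa using this
  · have key : ∀ x ∈ B ++ η, x ≠ u ∧ x ∉ Y ∧ f x ∉ Y := by
      intro x hx
      obtain ⟨h1, h2⟩ := hBη x hx
      refine ⟨hne x h1, fun h3 => hZf x h1 (hYZ x h3), fun h3 => h2 ?_⟩
      rw [hY, Set.mem_ofPred_eq, h.inv] at h3
      exact h3
    intro r hr
    simp only [List.mem_append, List.mem_reverse, List.mem_map] at hr
    rcases hr with hr | ⟨x, hx, rfl⟩
    · exact key r (List.mem_append_left _ hr)
    · have := key x (List.mem_append_right _ hx)
      exact ⟨h.apply_ne_root this.1, this.2.2, by rw [h.inv]; exact this.2.1⟩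

/-- If every vertex can be reached from `u` along arcs, every vertex lies in a flower or Tposy for
some matching missing only `u`. -/
theorem exists_memFlower_or_memTposy [Finite V] (h : IsMate G f u)
    (H : ∀ x, ReflTransGen (Arc G f) u x) (hV : ∃ z, z ≠ u) (v : V) :
    ∃ f', ∃ h' : IsMate G f' u, MemFlower h'.matching v ∨ MemTposy h'.matching v := by
  by_cases hF : ∃ Z, Consistent f u Z ∧ u ∈ Z ∧ (∀ y ∈ Z, ReflTransGen (Step G f u Z) u y) ∧
      (v ∈ Z ∨ f v ∈ Z)
  · obtain ⟨Z, h1, h2, h3, h4⟩ := hF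
    obtain ⟨f', h', h5⟩ := exists_memFlower h H hV h1 h2 h3 h4
    exact ⟨f', h', .inl h5⟩
  push Not at hF
  have hvu : v ≠ u := by
    rintro rfl
    refine (hF {v} ?_ rfl ?_).1 rfl
    · rintro y rfl _; rfl
    · rintro y rfl; exact .refl
  obtain ⟨Y₀, hY₀⟩ := exists_config h H hV hvu fun Z h1 h2 h3 => (hF Z h1 h2 h3).1
  obtain ⟨Y, -, hY⟩ := (Set.toFinite {Y | ∃ y₁ y₂ R, Config G f u v Y y₁ y₂ R}).exists_le_maximal
    (a := Y₀) hY₀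
  obtain ⟨y₁, y₂, R, c⟩ := hY.prop
  rcases c.exists_memTposy_or_larger h H hV fun Z h1 h2 h3 => (hF Z h1 h2 h3).2 with
    ⟨f', h', h1⟩ | ⟨Y', y₁', y₂', R', h1, h2⟩
  · exact ⟨f', h', .inr h1⟩
  · exact absurd (hY.le_of_ge ⟨y₁', y₂', R', h2⟩ h1.1) h1.2

end SterboulDeming

/-! ### From a Jflower to reachability of every vertex. -/

namespace SterboulDeming

variable {V : Type*} {G : SimpleGraph V} {f : V → V} {u v : V}

open Relation (ReflTransGen)

theorem length_add_one_le_of_alternating {α : Type*} {p : α → Prop} [DecidablePred p] :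
    ∀ l : List α, l.IsChain (fun e f => p e ↔ ¬ p f) → (∀ e ∈ l.head?, p e) → Odd l.length →
      l.length + 1 ≤ 2 * l.countP p
  | [], _, _, h => by simp at h
  | [a], _, h, _ => by simp [h a (by simp)]
  | a :: b :: l, hl, ha, ho => by
    have h1 := List.isChain_cons_cons.1 hl
    have h2 := List.isChain_cons.1 h1.2
    have hpa : p a := ha a (by simp)
    have hpb : ¬ p b := h1.1.1 hpa
    have := length_add_one_le_of_alternating l h2.2
      (fun e he => by have := h2.1 e he; tauto) (by simp at ho ⊢; grind)
    simp [hpa, hpb]; omega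

/-- With equality for odd length only if the list starts and ends in `p`; `reach_of_walk` reads the
positions of matching edges off this count. -/
theorem two_mul_countP_le {α : Type*} {p : α → Prop} [DecidablePred p] :
    ∀ l : List α, l.IsChain (fun e f => p e → ¬ p f) → 2 * l.countP p ≤ l.length + 1
  | [], _ => by simp
  | [a], _ => by
    have : [a].countP (fun x => decide (p x)) ≤ 1 := List.countP_le_length
    simp only [List.length_singleton]; omega
  | a :: b :: l, hl => by
    have h1 := List.isChain_cons_cons.1 hl
    have h2 := two_mul_countP_le l h1.2.tail
    have h3 := two_mul_countP_le (b :: l) h1.2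
    by_cases ha : p a
    · simp [ha, h1.1 ha]; omega
    · simp [ha] at h3 ⊢; omega

/-- A walk that starts and ends with edges of `M` and alternates in between yields an
implication walk from any neighbour of its start. -/
theorem reach_of_walk {M : G.Subgraph} [DecidablePred (· ∈ M.edgeSet)]
    (hf : ∀ x y, M.Adj x y → f x = y) {x y : V} : ∀ (p : G.Walk x y),
    p.edges.IsChain (fun e f => e ∈ M.edgeSet → f ∉ M.edgeSet) →
    p.length + 1 ≤ 2 * p.edges.countP (· ∈ M.edgeSet) → ∀ a, G.Adj a x →
    ReflTransGen (Arc G f) a y ∧ ∀ z ∈ p.support, z ∈ M.verts ∧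
      ∃ z', (z' = z ∨ z' = f z) ∧ ReflTransGen (Arc G f) a z' ∧ ReflTransGen (Arc G f) z' y
  | .nil, _, hc, _, _ => by simp at hc
  | .cons (v := m) e .nil, _, hc, a, ha => by
    have hM : M.Adj x m := by
      by_contra hM
      have : s(x, m) ∉ M.edgeSet := hM
      simp [this] at hc
    have hay : Arc G f a m := by unfold Arc; rwa [hf m x hM.symm]
    refine ⟨.single hay, fun z hz => ?_⟩
    simp only [SimpleGraph.Walk.support_cons, SimpleGraph.Walk.support_nil, List.mem_cons,
      List.not_mem_nil, or_false] at hz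
    rcases hz with rfl | rfl
    · exact ⟨hM.fst_mem, m, .inr (hf _ _ hM).symm, .single hay, .refl⟩
    · exact ⟨hM.snd_mem, z, .inl rfl, .single hay, .refl⟩
  | .cons (v := m) e (.cons (v := n) e' r), hch, hc, a, ha => by
    simp only [SimpleGraph.Walk.edges_cons] at hch
    have h1 := List.isChain_cons_cons.1 hch
    have hM : M.Adj x m := by
      by_contra hM
      have hM' : s(x, m) ∉ M.edgeSet := hM
      have h3 := two_mul_countP_le _ h1.2
      simp [hM'] at hc h3
      omega
    have hM' : s(x, m) ∈ M.edgeSet := hM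
    have hN : s(m, n) ∉ M.edgeSet := h1.1 hM'
    obtain ⟨h4, h5⟩ := reach_of_walk hf r h1.2.tail (by simp [hM', hN] at hc; omega) m e'
    have ham : Arc G f a m := by unfold Arc; rwa [hf m x hM.symm]
    refine ⟨.head ham h4, fun z hz => ?_⟩
    simp only [SimpleGraph.Walk.support_cons, List.mem_cons] at hz
    rcases hz with rfl | rfl | hz
    · exact ⟨hM.fst_mem, m, .inr (hf _ _ hM).symm, .single ham, h4⟩
    · exact ⟨hM.snd_mem, z, .inl rfl, .single ham, h4⟩
    · obtain ⟨h6, z', h7, h8, h9⟩ := h5 z hz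
      exact ⟨h6, z', h7, .head ham h8, h9⟩

theorem isChain_edges_of_isPath {M : G.Subgraph} (hM : M.IsMatching) {x y : V} :
    ∀ (p : G.Walk x y), p.IsPath →
      p.edges.IsChain fun e f => e ∈ M.edgeSet → f ∉ M.edgeSet
  | .nil, _ => by simp
  | .cons _ .nil, _ => by simp
  | .cons (v := m) e (.cons (v := n) e' r), hp => by
    have h1 := (SimpleGraph.Walk.cons_isPath_iff _ _).1 hp
    refine List.isChain_cons_cons.2 ⟨fun h2 h3 => h1.2 ?_, isChain_edges_of_isPath hM _ h1.1⟩
    have h2' : M.Adj m x := M.symm.symm _ _ h2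
    have h3' : M.Adj m n := h3
    rw [(hM h2'.fst_mem).unique h2' h3']
    simp

theorem exists_partner {M : G.Subgraph} (hM : M.IsMatching) : ∃ f : V → V,
    (∀ x y, M.Adj x y → f x = y) ∧ (∀ x ∈ M.verts, M.Adj x (f x)) ∧ ∀ x ∉ M.verts, f x = x := by
  have : ∀ x, ∃ y, (∀ z, M.Adj x z → y = z) ∧ (x ∈ M.verts → M.Adj x y) ∧
      (x ∉ M.verts → y = x) := by
    intro x
    by_cases hx : x ∈ M.verts
    · obtain ⟨y, hy, hy'⟩ := hM hx
      exact ⟨y, fun z hz => (hy' z hz).symm, fun _ => hy, fun h => absurd hx h⟩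
    · exact ⟨x, fun z hz => absurd hz.fst_mem hx, fun h => absurd h hx, fun _ => rfl⟩
  choose f hf using this
  exact ⟨f, fun x => (hf x).1, fun x => (hf x).2.1, fun x => (hf x).2.2⟩

theorem reach_of_blossom {M : G.Subgraph} (hM : M.IsMatching)
    (hf : ∀ x y, M.Adj x y → f x = y) (hff : ∀ x, f (f x) = x) {b : V} {C : G.Walk b b} (hC : IsBlossom M C) :
    ∃ c ∈ M.verts, ReflTransGen (Arc G f) b (f b) ∧ ∀ z ∈ C.support, z = b ∨ z ∈ M.verts ∧
      ∃ z', (z' = z ∨ z' = f z) ∧ ReflTransGen (Arc G f) b z' ∧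
        ReflTransGen (Arc G f) z' (f b) := by
  classical
  obtain ⟨hcyc, ⟨k, hk, hcount⟩, hbase⟩ := hC
  have h3 := hcyc.three_le_length
  cases C with
  | nil => simp at h3
  | @cons _ c _ h1 q =>
    have hq := ((SimpleGraph.Walk.cons_isCycle_iff _ _).1 hcyc).1.reverse
    have hqs : ∀ z, z ∈ q.support ↔ z ∈ q.reverse.support := by simp
    have hqe : ∀ e, e ∈ q.edges ↔ e ∈ q.reverse.edges := by simp
    have hql : q.length = q.reverse.length := by simp
    generalize q.reverse = q' at hq hqs hqe hql
    cases q' with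
    | nil =>
      simp only [SimpleGraph.Walk.length_cons, SimpleGraph.Walk.length_nil] at hql h3
      omega
    | @cons _ d _ h2 r =>
      have hr := ((SimpleGraph.Walk.cons_isPath_iff _ _).1 hq).1
      have hdC : d ∈ (SimpleGraph.Walk.cons h1 q).support := by simp [hqs]
      have hcC : c ∈ (SimpleGraph.Walk.cons h1 q).support := by simp
      have hd : s(b, d) ∉ M.edgeSet := hbase d hdC
      have hc : s(b, c) ∉ M.edgeSet := hbase c hcC
      -- Both edges at the base are outside `M`, so all `k` matching edges lie on `r`, which has
      -- length `2 * k - 1`.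
      have hle : k ≤ r.edges.countP (· ∈ M.edgeSet) := by
        rw [← hcount, List.countP_eq_length_filter]
        refine le_trans ?_ (List.toFinset_card_le _)
        rw [← Set.ncard_coe_finset]
        refine Set.ncard_le_ncard ?_ (Finset.finite_toSet _)
        rintro e ⟨he, heM⟩
        simp only [SimpleGraph.Walk.edges_cons, List.mem_cons, hqe] at he
        simp only [List.coe_toFinset, List.mem_filter, Set.mem_ofPred_eq, decide_eq_true_eq]
        rcases he with rfl | rfl | he
        exacts [absurd heM hc, absurd heM hd, ⟨he, heM⟩]
      simp only [SimpleGraph.Walk.length_cons] at hk hql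
      obtain ⟨h4, h5⟩ := reach_of_walk hf r (isChain_edges_of_isPath hM r hr) (by omega) b h2
      have h6 : Arc G f c (f b) := by unfold Arc; rw [hff]; exact h1.symm
      refine ⟨c, (h5 c (by simp)).1, h4.tail h6, fun z hz => ?_⟩
      simp only [SimpleGraph.Walk.support_cons, List.mem_cons, hqs] at hz
      rcases hz with hz | hz | hz
      · exact .inl hz
      · exact .inl hz
      · obtain ⟨h7, z', h8, h9, h10⟩ := h5 z hz
        exact .inr ⟨h7, z', h8, h9, h10.tail h6⟩

theorem reach_of_stem {M : G.Subgraph} (hf : ∀ x y, M.Adj x y → f x = y) {b : V}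
    {W : G.Walk b u} (hW : IsAlternatingWalk M W) (he : Even W.length) (hu : u ∉ M.verts) :
    ReflTransGen (Arc G f) u b ∧ ∀ z ∈ W.support, z = u ∨ z ∈ M.verts ∧
      ∃ z', (z' = z ∨ z' = f z) ∧ ReflTransGen (Arc G f) u z' ∧ ReflTransGen (Arc G f) z' b := by
  classical
  have hch : W.reverse.edges.IsChain fun e f => e ∈ M.edgeSet ↔ f ∉ M.edgeSet := by
    rw [SimpleGraph.Walk.edges_reverse, List.isChain_reverse]
    exact List.IsChain.imp (fun e f h => by tauto) hW
  have hs : ∀ z, z ∈ W.support ↔ z ∈ W.reverse.support := by simp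
  rw [← SimpleGraph.Walk.length_reverse] at he
  generalize W.reverse = W' at hch hs he
  cases W' with
  | nil => exact ⟨.refl, fun z hz => .inl (by simpa [hs] using hz)⟩
  | @cons _ d _ h1 p =>
    have hn : s(u, d) ∉ M.edgeSet := fun h => hu (M.edge_vert h)
    rw [SimpleGraph.Walk.edges_cons, List.isChain_cons] at hch
    have ho : Odd p.edges.length := by
      rw [SimpleGraph.Walk.length_edges]
      simpa [Nat.even_add_one] using he
    have hl := length_add_one_le_of_alternating p.edges hch.2
      (fun e h => by have := hch.1 e h; tauto) ho
    rw [SimpleGraph.Walk.length_edges] at hl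
    obtain ⟨h2, h3⟩ := reach_of_walk hf p (hch.2.imp fun e f h => h.1) hl u h1
    refine ⟨h2, fun z hz => ?_⟩
    rw [hs, SimpleGraph.Walk.support_cons, List.mem_cons] at hz
    exact hz.imp_right (h3 z)

theorem exists_isMate {M : G.Subgraph} (hM : M.IsMatching) {b : V} {C : G.Walk b b}
    {W : G.Walk b u} (hJ : IsJflower M C W) (hall : ∀ v, v ∈ C.support ∨ v ∈ W.support) :
    ∃ f, IsMate G f u ∧ M.verts = {x | x ≠ u} ∧ (∀ x, ReflTransGen (Arc G f) u x) ∧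
      ∃ z, z ≠ u := by
  obtain ⟨hC, hW, he, hu⟩ := hJ
  obtain ⟨f, hf, hf1, hf0⟩ := exists_partner hM
  have hff : ∀ x, f (f x) = x := fun x => by
    by_cases hx : x ∈ M.verts
    · exact hf _ _ (hf1 x hx).symm
    · rw [hf0 x hx, hf0 x hx]
  obtain ⟨c, hc, hbb, hCr⟩ := reach_of_blossom hM hf hff hC
  obtain ⟨hub, hWr⟩ := reach_of_stem hf hW he hu
  have hb := hWr b W.start_mem_support
  have hverts : ∀ x, x ≠ u → x ∈ M.verts := by
    intro x hx
    rcases hall x with h1 | h1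
    · rcases hCr x h1 with rfl | h2
      exacts [(hb.resolve_left hx).1, h2.1]
    · exact ((hWr x h1).resolve_left hx).1
  have h : IsMate G f u := ⟨hff, fun x hx => (hf1 x (hverts x hx)).adj_sub, hf0 u hu⟩
  refine ⟨f, h, ?_, ?_, c, fun e => hu (e ▸ hc)⟩
  · ext x
    exact ⟨fun hx e => hu (e ▸ hx), hverts x⟩
  · have hufb := hub.trans hbb
    -- A traversal reaches just one end of a matching edge; the other end comes from the conjugate
    -- of the remaining walk.
    have key : ∀ x z', (z' = x ∨ z' = f x) → ReflTransGen (Arc G f) u z' →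
        ReflTransGen (Arc G f) u (f z') → ReflTransGen (Arc G f) u x := by
      rintro x z' (rfl | rfl) h1 h2
      · exact h1
      · rwa [hff] at h2
    intro x
    rcases hall x with h1 | h1
    · rcases hCr x h1 with rfl | ⟨-, z', h2, h3, h4⟩
      · exact hub
      · refine key x z' h2 (hub.trans h3) (hub.trans ?_)
        have := h.reach_conj h4
        rwa [hff] at this
    · rcases hWr x h1 with rfl | ⟨-, z', h2, h3, h4⟩
      · exact .refl
      · exact key x z' h2 h3 (hufb.trans (h.reach_conj h4))

/-- Twice the number of edges is the degree sum, which counts the covered vertices. Hence every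
matching missing only `u` is maximum too. -/
theorem ncard_edgeSet_eq_of_verts_eq [Finite V] {M N : G.Subgraph} (hM : M.IsMatching)
    (hN : N.IsMatching) (hMN : M.verts = N.verts) : M.edgeSet.ncard = N.edgeSet.ncard := by
  classical
  have := Fintype.ofFinite V
  have key : ∀ K : G.Subgraph, K.IsMatching →
      2 * K.edgeSet.ncard = ∑ v, if v ∈ K.verts then 1 else 0 := by
    intro K hK
    rw [← SimpleGraph.Subgraph.edgeSet_spanningCoe, ← SimpleGraph.coe_edgeFinset,
      Set.ncard_coe_finset, ← SimpleGraph.sum_degrees_eq_twice_card_edges]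
    refine Finset.sum_congr rfl fun v _ => ?_
    rw [SimpleGraph.Subgraph.degree_spanningCoe]
    split_ifs with hv
    · exact SimpleGraph.Subgraph.isMatching_iff_forall_degree.1 hK v hv
    · exact SimpleGraph.Subgraph.degree_of_notMem_verts hv
  have h1 := key M hM
  rw [hMN, ← key N hN] at h1
  omega

end SterboulDeming

theorem mainTheorem3 {V : Type*} [Finite V] (G : SimpleGraph V)
    (hG : SterboulDeming.IsJflowerGraph G) (v : V) :
    ∃ M : G.Subgraph, SterboulDeming.IsMaximumMatching M ∧
      (SterboulDeming.MemFlower M v ∨ SterboulDeming.MemTposy M v) := by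
  obtain ⟨M, hM, b, u, C, W, hJ, hall, -⟩ := hG
  obtain ⟨f, h, hv, H, hV⟩ := SterboulDeming.exists_isMate hM.1 hJ hall
  obtain ⟨f', h', hmem⟩ := SterboulDeming.exists_memFlower_or_memTposy h H hV v
  refine ⟨h'.matching, ⟨h'.isMatching, fun N hN => (hM.2 N hN).trans_eq ?_⟩, hmem⟩
  exact SterboulDeming.ncard_edgeSet_eq_of_verts_eq hM.1 h'.isMatching hv
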